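/- **Setting.** Let $\mathcal X$ be an example space with a $\sigma$-finite reference measure $\nu$ (e.g. a measurable subset of $\mathbb R^d$ with Lebesgue measure), and let $P$ be a probability law of $(x,y)\in\mathcal X\times\{+1,-1\}$ whose $x$-marginal $p_U$ has a density with respect to $\nu$. Put $\pi_\pm=P(y=\pm1)$ and assume $\pi_+\ne\pi_-$. For independent $(x,y),(x',y')\sim P$ let $\pi_S=\Pr(y=y')$, $\pi_D=\Pr(y\ne y')$, let $p_S$, $p_D$ be the conditional laws of $(x,x')$ given $y=y'$, resp. $y\neq y'$, and let $\widetilde p_S,\widetilde p_D$ be their marginals. Let $\ell:\mathbb R\times\{\pm1\}\to[0,\infty)$ be $\rho$-Lipschitz in the first argument ($0<\rho<\infty$), let $R(f)=\mathbf E_P[\ell(f(x),y)]$, and put $$\mathcal L(z,t)=\frac{\pi_+\ell(z,t)-\pi_-\ell(z,-t)}{\pi_+-\pi_-},\qquad \widetilde{\mathcal L}(z)=\frac{\ell(z,+1)-\ell(z,-1)}{\pi_+-\pi_-}.$$ Given similar pairs $(x_{S,i},x'_{S,i})_{i\le n_S}$, dissimilar pairs $(x_{D,i},x'_{D,i})_{i\le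 n_D}$ and unlabeled points $(x_{U,i})_{i\le n_U}$, with $n_S,n_D,n_U\ge1$, the empirical risks are $$\widehat R_{SU}(f)=\frac{\pi_S}{n_S}\sum_i\frac{\widetilde{\mathcal L}(f(x_{S,i}))+\widetilde{\mathcal L}(f(x'_{S,i}))}2+\frac1{n_U}\sum_i\mathcal L(f(x_{U,i}),-1),$$ $$\widehat R_{DU}(f)=-\frac{\pi_D}{n_D}\sum_i\frac{\widetilde{\mathcal L}(f(x_{D,i}))+\widetilde{\mathcal L}(f(x'_{D,i}))}2+\frac1{n_U}\sum_i\mathcal L(f(x_{U,i}),+1),$$ $$\widehat R_{SD}(f)=\frac{\pi_S}{n_S}\sum_i\frac{\mathcal L(f(x_{S,i}),+1)+\mathcal L(f(x'_{S,i}),+1)}2+\frac{\pi_D}{n_D}\sum_i\frac{\mathcal L(f(x_{D,i}),-1)+\mathcal L(f(x'_{D,i}),-1)}2 .$$ Let $\gamma_1,\gamma_2,\gamma_3\ge0$ with $\gamma_1+\gamma_2+\gamma_3=1$ and $\widehat R_{SDU}=\gamma_1\widehat R_{SU}+\gamma_2\widehat R_{DU}+\gamma_3\widehat R_{SD}$.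 Let $\mathcal F$ be a class of measurable functions $\mathcal X\to\mathbb R$, pointwise measurable in the sense that every $f\in\mathcal F$ is the pointwise limit of a sequence from a fixed countable subset of $\mathcal F$, with $|f(x)|\le C_b$ for all $f\in\mathcal F$ and $x\in\mathcal X$, and suppose that its expected Rademacher complexity satisfies $\mathfrak R(\mathcal F;n,\mu)\le C_{\mathcal F}/\sqrt n$ for all $n\ge1$ and all probability measures $\mu$ having a density with respect to $\nu$. Let $C_\ell=\sup_{|z|\le C_b,\ t\in\{\pm1\}}\ell(z,t)$. Let $f^*$ be a minimizer of $R$ over $\mathcal F$ and $\widehat f_{SDU}$ a minimizer of $\widehat R_{SDU}$ over $\mathcal F$. For $\delta>0$ put $$C'_{\mathcal F,\ell,\delta}=\frac1{|\pi_+-\pi_-|}\Bigl(4\rho C_{\mathcal F}+\sqrt{2C_\ell^2\log\tfrac{12}\delta}\Bigr).$$ **Theorem.** Let the unlabeled points be i.i.d. with law $p_U$, and let $\delta>0$. (1) If the $2n_S$ points contained in the similar pairs are i.i.d. with law $\widetilde p_S$ and the $2n_D$ points contained in the dissimilar pairs are i.i.d. with law $\widetilde p_D$, then with probability at least $1-\delta$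 $$R(\widehat f_{SDU})-R(f^*)\le C'_{\mathcal F,\ell,\delta}\Bigl((2\gamma_1+\gamma_3)\frac{\pi_S}{\sqrt{2n_S}}+(2\gamma_2+\gamma_3)\frac{\pi_D}{\sqrt{2n_D}}+\bigl(|\gamma_1\pi_--\gamma_2\pi_+|+|\gamma_1\pi_+-\gamma_2\pi_-|\bigr)\frac1{\sqrt{n_U}}\Bigr).$$ (2) If instead only the pairs are independent, the similar ones i.i.d. with law $p_S$ and the dissimilar ones i.i.d. with law $p_D$, then the same holds with $\sqrt{n_S}$ and $\sqrt{n_D}$ in place of $\sqrt{2n_S}$ and $\sqrt{2n_D}$. -/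

import Mathlib

open MeasureTheory ProbabilityTheory Filter Topology
open scoped NNReal ENNReal

namespace SDU

noncomputable section

variable {X : Type*} [MeasurableSpace X]

/-! Labelled examples are elements of `X × ℤˣ`; the label space `{+1, -1}` is `ℤˣ`.
`P` is the joint law of `(x, y)`. -/

/-- The class prior `π_t = p(y = t)`. -/
def prior (P : Measure (X × ℤˣ)) (t : ℤˣ) : ℝ :=
  P.real {q | q.2 = t}

/-- The law of an unlabeled example, i.e. the `x`-marginal of `P`. -/
def unlabeledLaw (P : Measure (X × ℤˣ)) : Measure X :=
  P.map Prod.fst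

/-- The event `y = y'` for two labelled examples. -/
def sameLabel (X : Type*) : Set ((X × ℤˣ) × (X × ℤˣ)) :=
  {q | q.1.2 = q.2.2}

/-- The proportion of similar pairs, `π_S = p(y = y')`, for independent examples. -/
def simProp (P : Measure (X × ℤˣ)) : ℝ :=
  (P.prod P).real (sameLabel X)

/-- The proportion of dissimilar pairs, `π_D = p(y ≠ y')`, for independent examples. -/
def disProp (P : Measure (X × ℤˣ)) : ℝ :=
  (P.prod P).real (sameLabel X)ᶜ

/-- The law of a similar pair, `p_S(x, x') = p(x, x' | y = y')`. -/
def simPairLaw (P : Measure (X × ℤˣ)) : Measure (X × X) :=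
  ((P.prod P)[|sameLabel X]).map fun q => (q.1.1, q.2.1)

/-- The law of a dissimilar pair, `p_D(x, x') = p(x, x' | y ≠ y')`. -/
def disPairLaw (P : Measure (X × ℤˣ)) : Measure (X × X) :=
  ((P.prod P)[|(sameLabel X)ᶜ]).map fun q => (q.1.1, q.2.1)

/-- The pointwise law of similar data: the marginal of `p_S`. -/
def simPointLaw (P : Measure (X × ℤˣ)) : Measure X :=
  (simPairLaw P).map Prod.fst

/-- The pointwise law of dissimilar data: the marginal of `p_D`. -/
def disPointLaw (P : Measure (X × ℤˣ)) : Measure X :=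
  (disPairLaw P).map Prod.fst

/-- The classification risk `R(f) = E[ℓ(f(x), y)]`. -/
def risk (P : Measure (X × ℤˣ)) (l : ℝ → ℤˣ → ℝ) (f : X → ℝ) : ℝ :=
  ∫ q, l (f q.1) q.2 ∂P

/-- `𝓛(z, t) = (π₊ ℓ(z, t) - π₋ ℓ(z, -t)) / (π₊ - π₋)`. -/
def corrLoss (P : Measure (X × ℤˣ)) (l : ℝ → ℤˣ → ℝ) (z : ℝ) (t : ℤˣ) : ℝ :=
  prior P 1 / (prior P 1 - prior P (-1)) * l z t
    - prior P (-1) / (prior P 1 - prior P (-1)) * l z (-t)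

/-- `𝓛̃(z) = (ℓ(z, +1) - ℓ(z, -1)) / (π₊ - π₋)`. -/
def diffLoss (P : Measure (X × ℤˣ)) (l : ℝ → ℤˣ → ℝ) (z : ℝ) : ℝ :=
  1 / (prior P 1 - prior P (-1)) * l z 1 - 1 / (prior P 1 - prior P (-1)) * l z (-1)

/-- Sample mean over pairs of `(g(f(x)) + g(f(x'))) / 2`. -/
def pairMean {n : ℕ} (xs : Fin n → X × X) (f : X → ℝ) (g : ℝ → ℝ) : ℝ :=
  1 / (n : ℝ) * ∑ i, (g (f (xs i).1) + g (f (xs i).2)) / 2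

/-- Sample mean over points of `g(f(x))`. -/
def pointMean {n : ℕ} (xs : Fin n → X) (f : X → ℝ) (g : ℝ → ℝ) : ℝ :=
  1 / (n : ℝ) * ∑ i, g (f (xs i))

/-- The empirical SU risk. -/
def empSU (P : Measure (X × ℤˣ)) (l : ℝ → ℤˣ → ℝ) {nS nU : ℕ}
    (xS : Fin nS → X × X) (xU : Fin nU → X) (f : X → ℝ) : ℝ :=
  simProp P * pairMean xS f (diffLoss P l) + pointMean xU f (fun z => corrLoss P l z (-1))

/-- The empirical DU risk. -/
def empDU (P : Measure (X × ℤˣ)) (l : ℝ → ℤˣ → ℝ) {nD nU : ℕ}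
    (xD : Fin nD → X × X) (xU : Fin nU → X) (f : X → ℝ) : ℝ :=
  disProp P * pairMean xD f (fun z => -diffLoss P l z)
    + pointMean xU f (fun z => corrLoss P l z 1)

/-- The empirical SD risk. -/
def empSD (P : Measure (X × ℤˣ)) (l : ℝ → ℤˣ → ℝ) {nS nD : ℕ}
    (xS : Fin nS → X × X) (xD : Fin nD → X × X) (f : X → ℝ) : ℝ :=
  simProp P * pairMean xS f (fun z => corrLoss P l z 1)
    + disProp P * pairMean xD f (fun z => corrLoss P l z (-1))

/-- The combined empirical risk `γ₁ R̂_SU + γ₂ R̂_DU + γ₃ R̂_SD`. -/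
def empSDU (P : Measure (X × ℤˣ)) (l : ℝ → ℤˣ → ℝ) (γ₁ γ₂ γ₃ : ℝ) {nS nD nU : ℕ}
    (xS : Fin nS → X × X) (xD : Fin nD → X × X) (xU : Fin nU → X) (f : X → ℝ) : ℝ :=
  γ₁ * empSU P l xS xU f + γ₂ * empDU P l xD xU f + γ₃ * empSD P l xS xD f

/-- The expected Rademacher complexity of a class `F` for `n` i.i.d. points with law `μ`. The
expectation over the signs is the average over all `2 ^ n` sign vectors. -/
def rademacher (F : Set (X → ℝ)) (n : ℕ) (μ : Measure X) : ℝ :=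
  ∫ z : Fin n → X,
    (1 / 2 ^ n : ℝ) * ∑ σ : Fin n → ℤˣ,
      ⨆ f : F, 1 / (n : ℝ) * ∑ i, ((σ i : ℤ) : ℝ) * (f : X → ℝ) (z i)
    ∂(Measure.pi fun _ => μ)

/-- The supremum of the loss over predictions in `[-Cb, Cb]` and both labels. -/
def lossSup (l : ℝ → ℤˣ → ℝ) (Cb : ℝ) : ℝ :=
  ⨆ q : Set.Icc (-Cb) Cb × ℤˣ, l q.1 q.2

/-- The constant `(4 ρ C_F + √(2 C_ℓ² log (12 / δ))) / |π₊ - π₋|`. -/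
def boundConst (P : Measure (X × ℤˣ)) (ρ CF Cl δ : ℝ) : ℝ :=
  1 / |prior P 1 - prior P (-1)| * (4 * ρ * CF + √(2 * Cl ^ 2 * Real.log (12 / δ)))

/-- A class of measurable real functions containing a countable subclass whose sequential
pointwise limits exhaust it. -/
def PointwiseMeasurable (F : Set (X → ℝ)) : Prop :=
  (∀ f ∈ F, Measurable f) ∧
    ∃ F₀ ⊆ F, F₀.Countable ∧ ∀ f ∈ F, ∃ u : ℕ → X → ℝ,
      (∀ k, u k ∈ F₀) ∧ ∀ x, Tendsto (fun k => u k x) atTop (𝓝 (f x))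

/-- `Z₁, …, Zₙ` are independent with common law `Q`. -/
def IsIID {Ω E : Type*} [MeasurableSpace Ω] [MeasurableSpace E] (Pr : Measure Ω) {n : ℕ}
    (Z : Fin n → Ω → E) (Q : Measure E) : Prop :=
  iIndepFun Z Pr ∧ ∀ i, HasLaw (Z i) Q Pr

end

end SDU

open SDU

/-! The combined empirical risk is linear in `ℓ(·, +1)` and `ℓ(·, -1)`, so it splits into one sample
mean per data source, each with a single loss `combLoss l a b` (`empSDU_eq`). Replacing the sample
means by expectations gives exactly the classification risk (`risk_eq`): multiplied by `π_S` and
`π_D`, the similar and dissimilar expectations are combinations of the two class integrals with the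
priors as weights, and the coefficients of the losses undo this mixing when `π₊ ≠ π₋`. Comparing the
empirical minimizer with `f*` then costs twice the weighted sum of three uniform deviations over `F`
(`measure_excess_gt_le`).

Each deviation is treated classically. McDiarmid's inequality
(`hasSubgaussianMGF_of_bounded_differences`, obtained by tensorizing Hoeffding's lemma) concentrates
the largest deviation around its mean. Symmetrization (`integral_supDeviation_le`) bounds that mean
by twice the Rademacher complexity of the loss class, and contraction (`sum_iSup_contraction`)
removes the Lipschitz loss. Suprema are taken over a countable subclass; pointwise limits carry the
result to `F`.

The loss with coefficients `a`, `b` has Lipschitz constant `(|a| + |b|) ρ` and oscillation at most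
`(|a| + |b|) C_ℓ`. The three sums `|a| + |b|` are the weights in the bound, divided by `|π₊ - π₋|`.

The two claims differ only in the effective sample size. With independent points, `n` pairs are a
sample of `2 n` points; with independent pairs, the average over a pair counts as one observation.
-/

namespace SDU

/-! ### The bounded difference inequality -/

/-- Sub-Gaussian bounds tensorize: conditionally sub-Gaussian fluctuations in the second variable
and sub-Gaussian fluctuations of the partial mean in the first one. -/
lemma hasSubgaussianMGF_prod {A B : Type*} [MeasurableSpace A] [MeasurableSpace B]
    (μ : Measure A) [IsProbabilityMeasure μ] (ρ : Measure B) [IsProbabilityMeasure ρ]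
    {G : A × B → ℝ} (hG : Measurable G) {M : ℝ} (hM : ∀ q, |G q| ≤ M) {c₁ c₂ : ℝ≥0}
    (h₁ : HasSubgaussianMGF (fun x => ∫ y, G (x, y) ∂ρ - ∫ x', ∫ y, G (x', y) ∂ρ ∂μ) c₁ μ)
    (h₂ : ∀ x, HasSubgaussianMGF (fun y => G (x, y) - ∫ y', G (x, y') ∂ρ) c₂ ρ) :
    HasSubgaussianMGF (fun q => G q - ∫ q', G q' ∂(μ.prod ρ)) (c₁ + c₂) (μ.prod ρ) := by
  have hint : Integrable G (μ.prod ρ) :=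
    Integrable.of_bound hG.aestronglyMeasurable M (.of_forall fun q => hM q)
  have hexp : ∀ t, Integrable
      (fun q => Real.exp (t * (G q - ∫ q', G q' ∂(μ.prod ρ)))) (μ.prod ρ) := by
    intro t
    refine integrable_exp_mul_of_mem_Icc (a := -M - ∫ q', G q' ∂(μ.prod ρ))
      (b := M - ∫ q', G q' ∂(μ.prod ρ)) (by fun_prop) (.of_forall fun q => ?_)
    have := abs_le.1 (hM q)
    constructor <;> linarith
  refine ⟨hexp, fun t => ?_⟩
  have hm : ∫ q', G q' ∂(μ.prod ρ) = ∫ x', ∫ y, G (x', y) ∂ρ ∂μ := integral_prod _ hint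
  rw [mgf, integral_prod _ (hexp t)]
  set m := ∫ q', G q' ∂(μ.prod ρ)
  -- With `x` fixed, the exponent is the centered partial mean, constant in `y`, plus the
  -- fluctuation controlled by `h₂`.
  have key : ∀ x, ∫ y, Real.exp (t * (G (x, y) - m)) ∂ρ
      ≤ Real.exp (t * (∫ y, G (x, y) ∂ρ - m)) * Real.exp (c₂ * t ^ 2 / 2) := by
    intro x
    have h := (h₂ x).mgf_le t
    rw [mgf] at h
    calc ∫ y, Real.exp (t * (G (x, y) - m)) ∂ρ
        = ∫ y, Real.exp (t * (∫ y, G (x, y) ∂ρ - m))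
            * Real.exp (t * (G (x, y) - ∫ y', G (x, y') ∂ρ)) ∂ρ := by
          congr with y
          rw [← Real.exp_add]
          congr 1
          ring
      _ = Real.exp (t * (∫ y, G (x, y) ∂ρ - m))
            * ∫ y, Real.exp (t * (G (x, y) - ∫ y', G (x, y') ∂ρ)) ∂ρ := integral_const_mul _ _
      _ ≤ _ := by gcongr
  rw [← hm] at h₁
  calc ∫ x, ∫ y, Real.exp (t * (G (x, y) - m)) ∂ρ ∂μ
      ≤ ∫ x, Real.exp (t * (∫ y, G (x, y) ∂ρ - m)) * Real.exp (c₂ * t ^ 2 / 2) ∂μ :=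
        integral_mono (hexp t).integral_prod_left
          ((h₁.integrable_exp_mul t).mul_const _) key
    _ = mgf (fun x => ∫ y, G (x, y) ∂ρ - m) μ t * Real.exp (c₂ * t ^ 2 / 2) :=
        integral_mul_const _ _
    _ ≤ Real.exp (c₁ * t ^ 2 / 2) * Real.exp (c₂ * t ^ 2 / 2) := by
        gcongr
        exact h₁.mgf_le t
    _ = _ := by
        rw [← Real.exp_add]
        congr 1
        push_cast
        ring

/-- **Hoeffding's lemma** for a function of bounded oscillation. -/
lemma hasSubgaussianMGF_of_oscillation_le {A : Type*} [MeasurableSpace A] (μ : Measure A)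
    [IsProbabilityMeasure μ] {G : A → ℝ} (hG : Measurable G) {M : ℝ} (hM : ∀ x, |G x| ≤ M)
    {c : ℝ≥0} (hc : ∀ x y, |G x - G y| ≤ c) :
    HasSubgaussianMGF (fun x => G x - ∫ x', G x' ∂μ) ((c / 2) ^ 2) μ := by
  have : Nonempty A := nonempty_of_isProbabilityMeasure μ
  have hbdd : BddBelow (Set.range G) := ⟨-M, by rintro _ ⟨x, rfl⟩; exact (abs_le.1 (hM x)).1⟩
  -- An interval of length `c` starting at the infimum contains all values of `G`, whence the
  -- parameter `(c / 2) ^ 2`.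
  have h := hasSubgaussianMGF_of_mem_Icc (μ := μ) (X := G) (a := ⨅ x, G x) (b := (⨅ x, G x) + c)
    hG.aemeasurable (.of_forall fun x => ⟨ciInf_le hbdd x, ?_⟩)
  · simpa using h
  · have : G x - c ≤ ⨅ x, G x := le_ciInf fun y => by linarith [(abs_le.1 (hc x y)).2]
    linarith

/-- **McDiarmid's inequality** (moment generating function form): a function of `n` i.i.d.
variables with differences bounded by `c` is sub-Gaussian with parameter `n (c / 2) ^ 2`. -/
theorem hasSubgaussianMGF_of_bounded_differences {E : Type*} [MeasurableSpace E] (μ : Measure E)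
    [IsProbabilityMeasure μ] {M : ℝ} {c : ℝ≥0} (n : ℕ) (G : (Fin n → E) → ℝ) (hG : Measurable G)
    (hM : ∀ z, |G z| ≤ M) (hc : ∀ z i x, |G (Function.update z i x) - G z| ≤ c) :
    HasSubgaussianMGF (fun z => G z - ∫ z', G z' ∂(Measure.pi fun _ : Fin n => μ))
      (n * (c / 2) ^ 2) (Measure.pi fun _ : Fin n => μ) := by
  induction n with
  | zero =>
    have h0 : (fun z => G z - ∫ z', G z' ∂(Measure.pi fun _ : Fin 0 => μ)) = fun _ => 0 := by
      ext z
      have : G = fun _ => G z := funext fun z' => congrArg G (Subsingleton.elim _ _)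
      rw [this]
      simp
    rw [h0]
    simp
  | succ n ih =>
    set e := (MeasurableEquiv.piFinSuccAbove (fun _ : Fin (n + 1) => E) 0).symm
    have he : MeasurePreserving e (μ.prod (Measure.pi fun _ : Fin n => μ))
        (Measure.pi fun _ : Fin (n + 1) => μ) :=
      (measurePreserving_piFinSuccAbove (fun _ : Fin (n + 1) => μ) 0).symm _
    have heq : ∀ q : E × (Fin n → E), e q = Fin.cons q.1 q.2 := fun q => by
      simp [e, MeasurableEquiv.piFinSuccAbove, Fin.insertNthEquiv]
    have hGe : Measurable fun q => G (e q) := hG.comp e.measurable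
    have hcons : ∀ x x' (y : Fin n → E), |G (e (x, y)) - G (e (x', y))| ≤ c := by
      intro x x' y
      have := hc (Fin.cons x' y) 0 x
      rwa [Fin.update_cons_zero, ← heq (x, y), ← heq (x', y)] at this
    have hGint : ∀ x, Integrable (fun y => G (e (x, y))) (Measure.pi fun _ : Fin n => μ) :=
      fun x => Integrable.of_bound (hGe.comp measurable_prodMk_left).aestronglyMeasurable M
        (.of_forall fun y => hM _)
    have hprod := hasSubgaussianMGF_prod μ (Measure.pi fun _ : Fin n => μ) hGe
      (fun q => hM _) (c₁ := (c / 2) ^ 2) (c₂ := n * (c / 2) ^ 2) ?_ ?_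
    · have hint : ∫ q, G (e q) ∂(μ.prod (Measure.pi fun _ : Fin n => μ))
          = ∫ z, G z ∂(Measure.pi fun _ : Fin (n + 1) => μ) := he.integral_comp' _
      rw [hint] at hprod
      have hc' : ((n + 1 : ℕ) : ℝ≥0) * (c / 2) ^ 2 = (c / 2) ^ 2 + n * (c / 2) ^ 2 := by
        push_cast; ring
      rw [hc']
      refine ⟨fun t => ?_, fun t => ?_⟩
      · rw [← he.integrable_comp_emb e.measurableEmbedding]
        exact hprod.integrable_exp_mul t
      · rw [mgf, ← he.integral_comp']
        exact hprod.mgf_le t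
    -- Averaging over the last `n` coordinates keeps the oscillation in the first one below `c`, so
    -- Hoeffding's lemma contributes one `(c / 2) ^ 2`. The other `n` come from the induction
    -- hypothesis with the first coordinate frozen.
    · refine hasSubgaussianMGF_of_oscillation_le μ (M := M) ?_ (fun x => ?_) (fun x x' => ?_)
      · exact hGe.stronglyMeasurable.integral_prod_right.measurable
      · simpa using norm_integral_le_of_norm_le_const
          (μ := Measure.pi fun _ : Fin n => μ) (f := fun y => G (e (x, y)))
          (.of_forall fun y => hM (e (x, y)))
      · rw [← integral_sub (hGint x) (hGint x')]
        simpa using norm_integral_le_of_norm_le_const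
          (μ := Measure.pi fun _ : Fin n => μ) (f := fun y => G (e (x, y)) - G (e (x', y)))
          (.of_forall fun y => hcons x x' y)
    · refine fun x => ih (fun y => G (e (x, y))) (hGe.comp measurable_prodMk_left)
        (fun y => hM _) (fun y i x' => ?_)
      have := hc (Fin.cons x y) i.succ x'
      rw [← Fin.cons_update] at this
      simpa only [heq] using this

/-! ### The contraction principle -/

lemma bddAbove_range_of_abs_le {κ : Type*} {a : κ → ℝ} {B : ℝ} (h : ∀ k, |a k| ≤ B) :
    BddAbove (Set.range a) :=
  ⟨B, by rintro _ ⟨k, rfl⟩; exact (abs_le.1 (h k)).2⟩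

lemma sum_intUnits {α : Type*} [AddCommMonoid α] (f : ℤˣ → α) : ∑ s, f s = f 1 + f (-1) := by
  rw [UnitsInt.univ, Finset.sum_pair (by decide)]

lemma sum_signs_succ {n : ℕ} (f : (Fin (n + 1) → ℤˣ) → ℝ) :
    ∑ σ, f σ = ∑ s : ℤˣ, ∑ τ : Fin n → ℤˣ, f (Fin.cons s τ) := by
  rw [← (Fin.consEquiv fun _ => ℤˣ).sum_comp, Fintype.sum_prod_type]
  rfl

/-- For indices `k`, `k'` the left side involves `φ (a k) - φ (a k') ≤ K |a k - a k'|`. The sign of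
`a k - a k'` decides which of the two indices is inserted in which supremum on the right. -/
lemma iSup_add_iSup_contraction {κ : Type*} [Nonempty κ] {φ : ℝ → ℝ} {K : ℝ}
    (hφ : ∀ x y, |φ x - φ y| ≤ K * |x - y|) {c a : κ → ℝ} {B A : ℝ}
    (hc : ∀ k, |c k| ≤ B) (ha : ∀ k, |a k| ≤ A) :
    (⨆ k, (c k + φ (a k))) + (⨆ k, (c k - φ (a k)))
      ≤ (⨆ k, (c k + K * a k)) + ⨆ k, (c k - K * a k) := by
  have hKa : ∀ k, |K * a k| ≤ |K| * A := fun k => by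
    rw [abs_mul]; exact mul_le_mul_of_nonneg_left (ha k) (abs_nonneg K)
  have hp : BddAbove (Set.range fun k => c k + K * a k) :=
    bddAbove_range_of_abs_le (B := B + |K| * A) fun k =>
      (abs_add_le _ _).trans (add_le_add (hc k) (hKa k))
  have hm : BddAbove (Set.range fun k => c k - K * a k) :=
    bddAbove_range_of_abs_le (B := B + |K| * A) fun k =>
      (abs_sub _ _).trans (add_le_add (hc k) (hKa k))
  refine ciSup_add_ciSup_le fun k k' => ?_
  have h1 := (abs_le.1 (hφ (a k) (a k'))).2
  rcases abs_cases (a k - a k') with ⟨h, -⟩ | ⟨h, -⟩ <;> rw [h] at h1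
  · linarith [le_ciSup hp k, le_ciSup hm k']
  · linarith [le_ciSup hp k', le_ciSup hm k]

/-- The **contraction principle** for Rademacher averages, with an additional bounded offset. -/
theorem sum_iSup_contraction {κ : Type*} [Nonempty κ] {φ : ℝ → ℝ} {K : ℝ}
    (hφ : ∀ x y, |φ x - φ y| ≤ K * |x - y|) {A : ℝ} (n : ℕ) (a : κ → Fin n → ℝ)
    (ha : ∀ k i, |a k i| ≤ A) (b : κ → ℝ) {B : ℝ} (hb : ∀ k, |b k| ≤ B) :
    ∑ σ : Fin n → ℤˣ, ⨆ k, (b k + ∑ i, ((σ i : ℤ) : ℝ) * φ (a k i))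
      ≤ ∑ σ : Fin n → ℤˣ, ⨆ k, (b k + K * ∑ i, ((σ i : ℤ) : ℝ) * a k i) := by
  induction n generalizing b B with
  | zero => simp
  | succ n ih =>
    have hφa : ∀ k i, |φ (a k i)| ≤ |φ 0| + |K| * A := by
      intro k i
      have h1 := hφ (a k i) 0
      have h2 : |φ (a k i)| ≤ |φ (a k i) - φ 0| + |φ 0| := by
        simpa using abs_add_le (φ (a k i) - φ 0) (φ 0)
      have h3 : K * |a k i - 0| ≤ |K| * A := by
        rw [sub_zero]
        exact mul_le_mul (le_abs_self K) (ha k i) (abs_nonneg _) (abs_nonneg K)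
      linarith
    rw [sum_signs_succ, sum_signs_succ]
    -- This is why the offset is arbitrary: it absorbs the summand of coordinate `0` for a fixed
    -- sign. Once the other coordinates are contracted, they form in turn the offset for the
    -- two-term contraction over the sign of coordinate `0`.
    have step (s : ℤˣ) := ih (fun k i => a k i.succ) (fun k i => ha k i.succ)
      (fun k => b k + ((s : ℤ) : ℝ) * φ (a k 0)) (B := B + (|φ 0| + |K| * A)) (fun k =>
        (abs_add_le _ _).trans (add_le_add (hb k) (by
          rcases Int.units_eq_one_or s with rfl | rfl <;> simpa using hφa k 0)))
    calc ∑ s : ℤˣ, ∑ τ : Fin n → ℤˣ, ⨆ k, (b k + ∑ i,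
          (((Fin.cons s τ : Fin (n + 1) → ℤˣ) i : ℤ) : ℝ) * φ (a k i))
        = ∑ s : ℤˣ, ∑ τ : Fin n → ℤˣ, ⨆ k, (b k + ((s : ℤ) : ℝ) * φ (a k 0)
            + ∑ i, ((τ i : ℤ) : ℝ) * φ (a k i.succ)) := by
          simp only [Fin.sum_univ_succ, Fin.cons_zero, Fin.cons_succ, add_assoc]
      _ ≤ ∑ s : ℤˣ, ∑ τ : Fin n → ℤˣ, ⨆ k, (b k + ((s : ℤ) : ℝ) * φ (a k 0)
            + K * ∑ i, ((τ i : ℤ) : ℝ) * a k i.succ) := Finset.sum_le_sum fun s _ => step s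
      _ = ∑ τ : Fin n → ℤˣ, ∑ s : ℤˣ, ⨆ k, (b k + ((s : ℤ) : ℝ) * φ (a k 0)
            + K * ∑ i, ((τ i : ℤ) : ℝ) * a k i.succ) := Finset.sum_comm
      _ ≤ ∑ τ : Fin n → ℤˣ, ∑ s : ℤˣ, ⨆ k, (b k + ((s : ℤ) : ℝ) * (K * a k 0)
            + K * ∑ i, ((τ i : ℤ) : ℝ) * a k i.succ) := by
          refine Finset.sum_le_sum fun τ _ => ?_
          have hc : ∀ k, |b k + K * ∑ i, ((τ i : ℤ) : ℝ) * a k i.succ| ≤ B + |K| * (n * A) := by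
            intro k
            refine (abs_add_le _ _).trans (add_le_add (hb k) ?_)
            rw [abs_mul]
            refine mul_le_mul_of_nonneg_left ?_ (abs_nonneg K)
            refine (Finset.abs_sum_le_sum_abs _ _).trans ?_
            refine (Finset.sum_le_card_nsmul _ _ A fun i _ => ?_).trans (by simp)
            rcases Int.units_eq_one_or (τ i) with h | h <;> simpa [h] using ha k i.succ
          have := iSup_add_iSup_contraction hφ hc (fun k => ha k 0)
          rw [sum_intUnits, sum_intUnits]
          convert this using 3 <;> (ext k; simp; try ring)
      _ = ∑ s : ℤˣ, ∑ τ : Fin n → ℤˣ, ⨆ k, (b k + ((s : ℤ) : ℝ) * (K * a k 0)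
            + K * ∑ i, ((τ i : ℤ) : ℝ) * a k i.succ) := Finset.sum_comm
      _ = _ := by
          refine Finset.sum_congr rfl fun s _ => Finset.sum_congr rfl fun τ _ => ?_
          congr 1
          ext k
          rw [Fin.sum_univ_succ]
          simp only [Fin.cons_zero, Fin.cons_succ]
          ring

/-! ### Symmetrization and uniform deviations -/

/-- The supremum over a class of signed sample means. -/
noncomputable def signedSup {κ E : Type*} (h : κ → E → ℝ) {n : ℕ} (σ : Fin n → ℤˣ)
    (z : Fin n → E) : ℝ :=
  ⨆ k, 1 / (n : ℝ) * ∑ i, ((σ i : ℤ) : ℝ) * h k (z i)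

/-- The expected Rademacher complexity of an indexed class of functions. -/
noncomputable def indexedRademacher {κ E : Type*} [MeasurableSpace E] (h : κ → E → ℝ) (n : ℕ)
    (μ : Measure E) : ℝ :=
  ∫ z : Fin n → E, (1 / 2 ^ n : ℝ) * ∑ σ : Fin n → ℤˣ, signedSup h σ z ∂(Measure.pi fun _ => μ)

lemma abs_iSup_le_of_abs_le {κ : Type*} [Nonempty κ] {a : κ → ℝ} {B : ℝ} (h : ∀ k, |a k| ≤ B) :
    |⨆ k, a k| ≤ B := by
  obtain ⟨k⟩ := ‹Nonempty κ›
  have : Nonempty κ := ⟨k⟩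
  refine abs_le.2 ⟨(abs_le.1 (h k)).1.trans (le_ciSup (bddAbove_range_of_abs_le h) k), ?_⟩
  exact ciSup_le fun k => (abs_le.1 (h k)).2

lemma abs_mean_le {n : ℕ} (hn : 0 < n) {a : Fin n → ℝ} {B : ℝ} (h : ∀ i, |a i| ≤ B) :
    |1 / (n : ℝ) * ∑ i, a i| ≤ B := by
  have hn' : (0 : ℝ) < n := Nat.cast_pos.2 hn
  rw [abs_mul, abs_of_pos (by positivity), one_div, inv_mul_le_iff₀ hn']
  exact (Finset.abs_sum_le_sum_abs _ _).trans
    ((Finset.sum_le_card_nsmul _ _ B fun i _ => h i).trans (by simp))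

lemma abs_sign_mul (s : ℤˣ) (x : ℝ) : |((s : ℤ) : ℝ) * x| = |x| := by
  rcases Int.units_eq_one_or s with rfl | rfl <;> simp

lemma abs_signedMean_le {κ E : Type*} {h : κ → E → ℝ} {n : ℕ} {B : ℝ} (hn : 0 < n)
    (hB : ∀ k x, |h k x| ≤ B) (σ : Fin n → ℤˣ)
    (z : Fin n → E) (k : κ) : |1 / (n : ℝ) * ∑ i, ((σ i : ℤ) : ℝ) * h k (z i)| ≤ B :=
  abs_mean_le hn fun _ => (abs_sign_mul _ _).trans_le (hB k _)

section

variable {κ E : Type*} [MeasurableSpace E] {h : κ → E → ℝ} {n : ℕ} {B : ℝ}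

lemma measurable_signedSup [Countable κ] (hm : ∀ k, Measurable (h k)) (σ : Fin n → ℤˣ) :
    Measurable (signedSup h σ) := by
  refine Measurable.iSup fun k => ?_
  have := hm k
  fun_prop

lemma integrable_signedSup [Countable κ] [Nonempty κ] (hn : 0 < n) (hm : ∀ k, Measurable (h k))
    (hB : ∀ k x, |h k x| ≤ B) (σ : Fin n → ℤˣ) (ρ : Measure (Fin n → E)) [IsFiniteMeasure ρ] :
    Integrable (signedSup h σ) ρ :=
  Integrable.of_bound (measurable_signedSup hm σ).aestronglyMeasurable B
    (.of_forall fun z => abs_iSup_le_of_abs_le (abs_signedMean_le hn hB σ z))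

lemma indexedRademacher_eq [Countable κ] [Nonempty κ] (hn : 0 < n) (hm : ∀ k, Measurable (h k))
    (hB : ∀ k x, |h k x| ≤ B) (μ : Measure E) [IsProbabilityMeasure μ] :
    indexedRademacher h n μ
      = (1 / 2 ^ n : ℝ) * ∑ σ : Fin n → ℤˣ, ∫ z, signedSup h σ z ∂(Measure.pi fun _ => μ) := by
  rw [indexedRademacher, integral_const_mul,
    integral_finsetSum _ fun σ _ => integrable_signedSup hn hm hB σ _]

/-- The largest excess of an expectation over the corresponding sample mean. -/
noncomputable def supDeviation (h : κ → E → ℝ) (μ : Measure E) {n : ℕ} (z : Fin n → E) : ℝ :=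
  ⨆ k, (∫ x, h k x ∂μ - 1 / (n : ℝ) * ∑ i, h k (z i))

lemma abs_deviation_le (hn : 0 < n) (hB : ∀ k x, |h k x| ≤ B) (μ : Measure E)
    [IsProbabilityMeasure μ] (z : Fin n → E) (k : κ) :
    |∫ x, h k x ∂μ - 1 / (n : ℝ) * ∑ i, h k (z i)| ≤ 2 * B := by
  have h1 : |∫ x, h k x ∂μ| ≤ B := by
    simpa using norm_integral_le_of_norm_le_const (μ := μ) (f := h k) (.of_forall (hB k))
  have h2 := abs_mean_le hn (fun i => hB k (z i))
  linarith [abs_sub (∫ x, h k x ∂μ) (1 / (n : ℝ) * ∑ i, h k (z i))]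

lemma measurable_supDeviation [Countable κ] (hm : ∀ k, Measurable (h k)) (μ : Measure E) :
    Measurable (supDeviation h μ (n := n)) := by
  refine Measurable.iSup fun k => ?_
  have := hm k
  fun_prop

lemma integral_mean {μ : Measure E} [IsProbabilityMeasure μ] (hn : 0 < n) {g : E → ℝ}
    (hg : Integrable g μ) :
    ∫ z : Fin n → E, 1 / (n : ℝ) * ∑ i, g (z i) ∂(Measure.pi fun _ => μ) = ∫ x, g x ∂μ := by
  have hn' : (n : ℝ) ≠ 0 := by positivity
  have hi (i : Fin n) : Integrable (fun z : Fin n → E => g (z i)) (Measure.pi fun _ => μ) :=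
    (measurePreserving_eval (fun _ : Fin n => μ) i).integrable_comp_of_integrable hg
  rw [integral_const_mul, integral_finsetSum _ fun i _ => hi i]
  have : ∀ i : Fin n, ∫ z : Fin n → E, g (z i) ∂(Measure.pi fun _ => μ) = ∫ x, g x ∂μ := fun i =>
    integral_comp_eval hg.aestronglyMeasurable
  simp [this, hn']

/-- **Symmetrization**: the expected largest deviation is at most twice the Rademacher
complexity. -/
theorem integral_supDeviation_le [Countable κ] [Nonempty κ] (hn : 0 < n)
    (hm : ∀ k, Measurable (h k)) (hB : ∀ k x, |h k x| ≤ B) (μ : Measure E)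
    [IsProbabilityMeasure μ] :
    ∫ z, supDeviation h μ z ∂(Measure.pi fun _ : Fin n => μ) ≤ 2 * indexedRademacher h n μ := by
  set Q := Measure.pi fun _ : Fin n => μ
  set W := Measure.pi fun _ : Fin n => μ.prod μ
  set D : (Fin n → E × E) → ℝ := fun w => ⨆ k, 1 / (n : ℝ) * ∑ i, (h k (w i).1 - h k (w i).2)
  have hDb : ∀ (w : Fin n → E × E) k, |1 / (n : ℝ) * ∑ i, (h k (w i).1 - h k (w i).2)| ≤ 2 * B :=
    fun w k => abs_mean_le hn fun i => by
      linarith [abs_sub (h k (w i).1) (h k (w i).2), hB k (w i).1, hB k (w i).2]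
  have hDm : Measurable D := by
    refine Measurable.iSup fun k => ?_
    have := hm k
    fun_prop
  have hDi (ρ : Measure (Fin n → E × E)) [IsFiniteMeasure ρ] : Integrable D ρ :=
    Integrable.of_bound hDm.aestronglyMeasurable (2 * B)
      (.of_forall fun w => abs_iSup_le_of_abs_le (hDb w))
  have hint : ∀ k, Integrable (h k) μ := fun k =>
    Integrable.of_bound (hm k).aestronglyMeasurable B (.of_forall (hB k))
  -- The expectation is the mean of an independent ghost sample `z'`, and a supremum of integrals is
  -- at most the integral of the supremum.
  have ghost : ∫ z, supDeviation h μ z ∂Q ≤ ∫ w, D w ∂W := by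
    have he := (measurePreserving_arrowProdEquivProdArrow E E (Fin n)
      (fun _ => μ) (fun _ => μ)).symm
    rw [← he.integral_comp']
    set e := (MeasurableEquiv.arrowProdEquivProdArrow E E (Fin n)).symm
    have heq : ∀ z z' i, e (z, z') i = (z i, z' i) := fun z z' i => rfl
    have hDe : Integrable (fun q => D (e q)) (Q.prod Q) :=
      Integrable.of_bound (hDm.comp e.measurable).aestronglyMeasurable (2 * B)
        (.of_forall fun q => abs_iSup_le_of_abs_le (hDb _))
    rw [integral_prod_symm _ hDe]
    refine integral_mono ?_ hDe.integral_prod_right fun z => ciSup_le fun k => ?_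
    · exact Integrable.of_bound (measurable_supDeviation hm μ).aestronglyMeasurable (2 * B)
        (.of_forall fun z => abs_iSup_le_of_abs_le (abs_deviation_le hn hB μ z))
    · have hmean : Integrable (fun z' : Fin n → E => 1 / (n : ℝ) * ∑ i, h k (z' i)) Q :=
        (integrable_finsetSum _ fun i _ => (measurePreserving_eval
          (fun _ : Fin n => μ) i).integrable_comp_of_integrable (hint k)).const_mul _
      calc ∫ x, h k x ∂μ - 1 / (n : ℝ) * ∑ i, h k (z i)
          = ∫ z' : Fin n → E, (1 / (n : ℝ) * ∑ i, h k (z' i) - 1 / (n : ℝ) * ∑ i, h k (z i)) ∂Q := by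
            rw [integral_sub hmean (integrable_const _), integral_mean hn (hint k)]
            simp
        _ ≤ ∫ z', D (e (z', z)) ∂Q := by
            refine integral_mono (hmean.sub (integrable_const _)) ?_ fun z' => ?_
            · exact Integrable.of_bound
                (hDm.comp (e.measurable.comp measurable_prodMk_right)).aestronglyMeasurable (2 * B)
                (.of_forall fun q => abs_iSup_le_of_abs_le (hDb _))
            · refine le_trans (le_of_eq ?_)
                (le_ciSup (bddAbove_range_of_abs_le (hDb (e (z', z)))) k)
              simp only [heq, Finset.sum_sub_distrib, mul_sub]
  -- Exchanging the two copies at the indices with `σ i = -1` preserves `W` and multiplies the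
  -- `i`-th difference by `σ i`. The supremum then splits into one term for each copy.
  have swap (σ : Fin n → ℤˣ) : ∫ w, D w ∂W
      ≤ ∫ z, signedSup h σ z ∂Q + ∫ z, signedSup h (fun i => -σ i) z ∂Q := by
    have hfst : MeasurePreserving (fun (w : Fin n → E × E) i => (w i).1) W Q :=
      measurePreserving_pi _ _ fun _ => measurePreserving_fst
    have hsnd : MeasurePreserving (fun (w : Fin n → E × E) i => (w i).2) W Q :=
      measurePreserving_pi _ _ fun _ => measurePreserving_snd
    have hswap : MeasurePreserving
        (fun (w : Fin n → E × E) i => if σ i = 1 then w i else (w i).swap) W W := by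
      refine measurePreserving_pi (f := fun i (q : E × E) => if σ i = 1 then q else q.swap)
        (fun _ => μ.prod μ) (fun _ => μ.prod μ) fun i => ?_
      by_cases hi : σ i = 1
      · simp only [hi, if_true]
        exact MeasurePreserving.id _
      · simpa [hi] using Measure.measurePreserving_swap (μ := μ) (ν := μ)
    have hi1 : Integrable (fun w : Fin n → E × E => signedSup h σ fun i => (w i).1) W :=
      hfst.integrable_comp_of_integrable (integrable_signedSup hn hm hB σ Q)
    have hi2 : Integrable (fun w : Fin n → E × E => signedSup h (fun i => -σ i) fun i => (w i).2)
        W := hsnd.integrable_comp_of_integrable (integrable_signedSup hn hm hB (fun i => -σ i) Q)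
    calc ∫ w, D w ∂W = ∫ w, D (fun i => if σ i = 1 then w i else (w i).swap) ∂W := by
          conv_lhs => rw [← hswap.map_eq]
          rw [integral_map hswap.aemeasurable hDm.aestronglyMeasurable]
      _ ≤ ∫ w : Fin n → E × E, (signedSup h σ (fun i => (w i).1)
          + signedSup h (fun i => -σ i) (fun i => (w i).2)) ∂W := by
          refine integral_mono (hswap.integrable_comp_of_integrable (hDi W))
            (hi1.add hi2) fun w => ciSup_le fun k => ?_
          have h1 := le_ciSup (bddAbove_range_of_abs_le
            (abs_signedMean_le hn hB σ fun i => (w i).1)) k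
          have h2 := le_ciSup (bddAbove_range_of_abs_le
            (abs_signedMean_le hn hB (fun i => -σ i) fun i => (w i).2)) k
          refine le_trans (le_of_eq ?_) (add_le_add h1 h2)
          rw [← mul_add, ← Finset.sum_add_distrib]
          congr 1
          refine Finset.sum_congr rfl fun i _ => ?_
          rcases Int.units_eq_one_or (σ i) with hi | hi
          · simp [hi]; ring
          · simp [hi]; ring
      _ = _ := by
          rw [integral_add hi1 hi2]
          congr 1
          · conv_rhs => rw [← hfst.map_eq]
            rw [integral_map hfst.aemeasurable (measurable_signedSup hm σ).aestronglyMeasurable]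
          · conv_rhs => rw [← hsnd.map_eq]
            rw [integral_map hsnd.aemeasurable (measurable_signedSup hm _).aestronglyMeasurable]
  rw [indexedRademacher_eq hn hm hB μ]
  refine ghost.trans ?_
  have hsum := Finset.sum_le_sum (s := Finset.univ) fun σ _ => swap σ
  -- Negation permutes the sign vectors, so both halves have the same sum; this is the source of the
  -- factor `2`.
  have hneg : ∑ σ : Fin n → ℤˣ, ∫ z, signedSup h (fun i => -σ i) z ∂Q
      = ∑ σ : Fin n → ℤˣ, ∫ z, signedSup h σ z ∂Q :=
    Equiv.sum_comp (Equiv.neg (Fin n → ℤˣ)) fun σ => ∫ z, signedSup h σ z ∂Q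
  rw [Finset.sum_add_distrib, hneg, Finset.sum_const, Finset.card_univ, Fintype.card_fun,
    Fintype.card_fin, Fintype.card_units_int, nsmul_eq_mul] at hsum
  push_cast at hsum
  have h2 : (0 : ℝ) < 2 ^ n := by positivity
  rw [one_div, ← mul_assoc, mul_comm (2 : ℝ), mul_assoc, ← div_eq_inv_mul, le_div_iff₀ h2]
  linarith

/-- **Uniform deviations**: with probability at least `1 - exp (-L)` every expectation exceeds the
corresponding sample mean by at most `2 ℜ + r √(L / (2 n))`. -/
theorem measure_exists_deviation_gt_le [Countable κ] [Nonempty κ] (hn : 0 < n)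
    (hm : ∀ k, Measurable (h k)) (hB : ∀ k x, |h k x| ≤ B) {r : ℝ≥0}
    (hr : ∀ k x y, |h k x - h k y| ≤ r) (μ : Measure E) [IsProbabilityMeasure μ] {L : ℝ}
    (hL : 0 ≤ L) :
    (Measure.pi fun _ : Fin n => μ) {z | ∃ k, 2 * indexedRademacher h n μ + r * √(L / (2 * n))
      < ∫ x, h k x ∂μ - 1 / (n : ℝ) * ∑ i, h k (z i)} ≤ ENNReal.ofReal (Real.exp (-L)) := by
  set Q := Measure.pi fun _ : Fin n => μ
  have hn' : (0 : ℝ) < n := Nat.cast_pos.2 hn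
  have hbd (z : Fin n → E) := bddAbove_range_of_abs_le (abs_deviation_le hn hB μ z)
  -- One direction suffices: applied at the updated point and restoring the old coordinate, it gives
  -- the reverse bound.
  have hcoord : ∀ (z : Fin n → E) i x, supDeviation h μ (Function.update z i x)
      ≤ supDeviation h μ z + r / n := by
    intro z i x
    refine ciSup_le fun k => ?_
    have h1 : ∫ x, h k x ∂μ - 1 / (n : ℝ) * ∑ j, h k (z j) ≤ supDeviation h μ z :=
      le_ciSup (hbd z) k
    have h2 : ∑ j, h k (z j) - ∑ j, h k (Function.update z i x j) = h k (z i) - h k x := by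
      rw [← Finset.sum_sub_distrib, Finset.sum_eq_single i]
      · simp
      · intro j _ hj
        simp [Function.update_of_ne hj]
      · simp
    have h3 : 1 / (n : ℝ) * (∑ j, h k (z j) - ∑ j, h k (Function.update z i x j)) ≤ r / n := by
      rw [h2, one_div_mul_eq_div]
      gcongr
      exact (abs_le.1 (hr k _ _)).2
    linarith
  have hsub := hasSubgaussianMGF_of_bounded_differences μ (M := 2 * B) (c := r / n) n
    (supDeviation h μ) (measurable_supDeviation hm μ)
    (fun z => abs_iSup_le_of_abs_le (abs_deviation_le hn hB μ z)) (fun z i x => by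
      rw [abs_le]
      push_cast
      have := hcoord (Function.update z i x) i (z i)
      rw [Function.update_idem, Function.update_eq_self] at this
      exact ⟨by linarith, by linarith [hcoord z i x]⟩)
  have hsym := integral_supDeviation_le hn hm hB μ
  have hincl : {z : Fin n → E | ∃ k, 2 * indexedRademacher h n μ + r * √(L / (2 * n))
      < ∫ x, h k x ∂μ - 1 / (n : ℝ) * ∑ i, h k (z i)}
      ⊆ {z | r * √(L / (2 * n)) < supDeviation h μ z - ∫ z', supDeviation h μ z' ∂Q} := by
    rintro z ⟨k, hk⟩
    have : ∫ x, h k x ∂μ - 1 / (n : ℝ) * ∑ j, h k (z j) ≤ supDeviation h μ z := le_ciSup (hbd z) k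
    rw [Set.mem_ofPred_eq]
    linarith
  refine (measure_mono hincl).trans ?_
  -- For `r = 0` the Chernoff exponent would be divided by zero; instead, parameter `0` forces the
  -- centered supremum to vanish almost everywhere.
  rcases eq_or_ne r 0 with rfl | hr0
  · simp only [zero_div, ne_eq, OfNat.ofNat_ne_zero, not_false_eq_true, zero_pow, mul_zero] at hsub
    have h0 := hsub.ae_eq_zero_of_hasSubgaussianMGF_zero
    have : Q {z | ((0 : ℝ≥0) : ℝ) * √(L / (2 * n))
        < supDeviation h μ z - ∫ z', supDeviation h μ z' ∂Q} = 0 := by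
      refine measure_mono_null (fun z hz => ?_) (ae_iff.1 h0)
      simp only [NNReal.coe_zero, zero_mul, Set.mem_ofPred_eq, Pi.zero_apply] at hz ⊢
      exact hz.ne'
    rw [this]
    exact zero_le
  · have hr1 : (0 : ℝ) < r := by positivity
    have htail := hsub.measure_ge_le (ε := r * √(L / (2 * n))) (by positivity)
    -- The sub-Gaussian parameter is `r ^ 2 / (4 n)`, and the threshold is chosen to make the
    -- exponent exactly `-L`.
    have hexp : -(r * √(L / (2 * n))) ^ 2 / (2 * ((n * (r / n / 2) ^ 2 : ℝ≥0) : ℝ)) = -L := by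
      rw [mul_pow, Real.sq_sqrt (by positivity)]
      push_cast
      field_simp
    rw [hexp] at htail
    calc Q {z | r * √(L / (2 * n)) < supDeviation h μ z - ∫ z', supDeviation h μ z' ∂Q}
        ≤ Q {z | r * √(L / (2 * n)) ≤ supDeviation h μ z - ∫ z', supDeviation h μ z' ∂Q} :=
          measure_mono fun z hz => by
            rw [Set.mem_ofPred_eq] at hz ⊢
            exact hz.le
      _ ≤ _ := by
          rw [← ofReal_measureReal]
          exact ENNReal.ofReal_le_ofReal htail

end

/-! ### Deviations of a loss composed with a pointwise measurable class -/

/-- Two-sided uniform deviations for a family `H f`, `f ∈ F`, that depends continuously on `f` and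
so is determined by a countable subclass `F₀`. -/
lemma measure_exists_abs_deviation_gt_le {X E : Type*} [MeasurableSpace E] {F F₀ : Set (X → ℝ)}
    (hne : F.Nonempty) (hF₀ : F₀.Countable)
    (hlim : ∀ f ∈ F, ∃ u : ℕ → X → ℝ, (∀ k, u k ∈ F₀) ∧
      ∀ x, Tendsto (fun k => u k x) atTop (𝓝 (f x)))
    (H : (X → ℝ) → E → ℝ) (hH : ∀ f ∈ F₀, Measurable (H f)) {B : ℝ}
    (hB : ∀ f ∈ F₀, ∀ q, |H f q| ≤ B)
    (hcont : ∀ (u : ℕ → X → ℝ) f, (∀ x, Tendsto (fun k => u k x) atTop (𝓝 (f x))) →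
      ∀ q, Tendsto (fun k => H (u k) q) atTop (𝓝 (H f q)))
    {r : ℝ≥0} (hr : ∀ f ∈ F₀, ∀ q q', |H f q - H f q'| ≤ r) (μ : Measure E)
    [IsProbabilityMeasure μ] {n : ℕ} (hn : 0 < n) {R : ℝ}
    (hR : indexedRademacher (fun f : F₀ => H f) n μ ≤ R)
    (hR' : indexedRademacher (fun f : F₀ => -H f) n μ ≤ R) {L : ℝ} (hL : 0 ≤ L) :
    (Measure.pi fun _ : Fin n => μ) {z | ∃ f ∈ F, 2 * R + r * √(L / (2 * n))
      < |∫ x, H f x ∂μ - 1 / (n : ℝ) * ∑ i, H f (z i)|} ≤ 2 * ENNReal.ofReal (Real.exp (-L)) := by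
  have : Countable F₀ := hF₀
  have : Nonempty F₀ := by
    obtain ⟨f, hf⟩ := hne
    obtain ⟨u, hu, -⟩ := hlim f hf
    exact ⟨⟨u 0, hu 0⟩⟩
  have h1 := measure_exists_deviation_gt_le (h := fun f : F₀ => H f) hn (fun f => hH f f.2)
    (fun f => hB f f.2) (fun f => hr f f.2) μ hL
  have h2 := measure_exists_deviation_gt_le (h := fun f : F₀ => -H f) hn
    (fun f => (hH f f.2).neg) (fun f q => by simpa using hB f f.2 q)
    (r := r) (fun f q q' => by
      rw [Pi.neg_apply, Pi.neg_apply, neg_sub_neg, abs_sub_comm]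
      exact hr f f.2 q q') μ hL
  rw [two_mul (ENNReal.ofReal _)]
  refine le_trans (measure_mono fun z hz => ?_)
    ((measure_union_le _ _).trans (add_le_add h1 h2))
  obtain ⟨f, hf, hlt⟩ := hz
  obtain ⟨u, hu, hconv⟩ := hlim f hf
  have hint : Tendsto (fun k => ∫ x, H (u k) x ∂μ) atTop (𝓝 (∫ x, H f x ∂μ)) :=
    tendsto_integral_of_dominated_convergence (fun _ => B)
      (fun k => (hH _ (hu k)).aestronglyMeasurable) (integrable_const _)
      (fun k => .of_forall fun q => hB _ (hu k) q) (.of_forall fun q => hcont u f hconv q)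
  have hsum : Tendsto (fun k => 1 / (n : ℝ) * ∑ i, H (u k) (z i)) atTop
      (𝓝 (1 / (n : ℝ) * ∑ i, H f (z i))) :=
    (tendsto_finsetSum _ fun i _ => hcont u f hconv (z i)).const_mul _
  obtain ⟨k, hk⟩ := ((hint.sub hsum).abs.eventually_const_lt hlt).exists
  rcases lt_abs.1 hk with hk | hk
  · exact Or.inl ⟨⟨u k, hu k⟩, by dsimp only; linarith⟩
  · refine Or.inr ⟨⟨u k, hu k⟩, ?_⟩
    simp only [Pi.neg_apply, integral_neg, Finset.sum_neg_distrib]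
    linarith

/-- Lets `n` pairs of independent points be treated as one sample of size `n + n`. -/
lemma pairMean_eq_pointMean_append {X : Type*} {n : ℕ} (w : Fin n → X × X) (f : X → ℝ) (g : ℝ → ℝ) :
    pairMean w f g = pointMean (Fin.append (fun i => (w i).1) (fun i => (w i).2)) f g := by
  rw [pairMean, pointMean, Fin.sum_univ_add, ← Finset.sum_div, Finset.sum_add_distrib]
  simp only [Fin.append_left, Fin.append_right]
  push_cast
  rw [← two_mul (n : ℝ)]
  ring

section

variable {X : Type*} [MeasurableSpace X]

/-- For fixed signs and sample points the signed mean is continuous under pointwise convergence, so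
the countable subclass has the same supremum. This transfers the assumed bound to a class with
measurable suprema. -/
lemma rademacher_eq_indexedRademacher {F F₀ : Set (X → ℝ)} (hsub : F₀ ⊆ F) (hne : F.Nonempty)
    {Cb : ℝ} (hCb : ∀ f ∈ F, ∀ x, |f x| ≤ Cb)
    (hlim : ∀ f ∈ F, ∃ u : ℕ → X → ℝ, (∀ k, u k ∈ F₀) ∧
      ∀ x, Tendsto (fun k => u k x) atTop (𝓝 (f x)))
    {n : ℕ} (hn : 0 < n) (μ : Measure X) :
    rademacher F n μ = indexedRademacher (fun f : F₀ => (f : X → ℝ)) n μ := by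
  have : Nonempty F := hne.to_subtype
  have : Nonempty F₀ := by
    obtain ⟨f, hf⟩ := hne
    obtain ⟨u, hu, -⟩ := hlim f hf
    exact ⟨⟨u 0, hu 0⟩⟩
  rw [rademacher, indexedRademacher]
  congr with z
  congr 1
  refine Finset.sum_congr rfl fun σ _ => ?_
  have hb := bddAbove_range_of_abs_le
    (abs_signedMean_le (h := fun f : F => (f : X → ℝ)) hn (fun f => hCb f f.2) σ z)
  have hb₀ := bddAbove_range_of_abs_le
    (abs_signedMean_le (h := fun f : F₀ => (f : X → ℝ)) hn (fun f => hCb f (hsub f.2)) σ z)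
  refine le_antisymm (ciSup_le fun f => ?_) (ciSup_le fun f => le_ciSup hb ⟨f, hsub f.2⟩)
  obtain ⟨u, hu, hconv⟩ := hlim f f.2
  refine le_of_tendsto' ((tendsto_finsetSum _ fun i _ => (hconv (z i)).const_mul _).const_mul _)
    fun k => le_ciSup hb₀ ⟨u k, hu k⟩

lemma indexedRademacher_comp_le {κ : Type*} [Countable κ] [Nonempty κ] {h : κ → X → ℝ}
    (hm : ∀ k, Measurable (h k)) {A : ℝ} (hA : ∀ k x, |h k x| ≤ A) {g : ℝ → ℝ} {K : ℝ≥0}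
    (hg : LipschitzWith K g) {n : ℕ} (hn : 0 < n) (μ : Measure X) [IsProbabilityMeasure μ] :
    indexedRademacher (fun k x => g (h k x)) n μ ≤ K * indexedRademacher h n μ := by
  have hφ : ∀ x y, |g x - g y| ≤ K * |x - y| := fun x y => by
    simpa [Real.dist_eq] using hg.dist_le_mul x y
  have hgA : ∀ k x, |g (h k x)| ≤ |g 0| + K * A := fun k x => by
    have h1 := hφ (h k x) 0
    have h2 : |g (h k x)| ≤ |g (h k x) - g 0| + |g 0| := by
      simpa using abs_add_le (g (h k x) - g 0) (g 0)
    have h3 : (K : ℝ) * |h k x - 0| ≤ K * A := by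
      rw [sub_zero]
      exact mul_le_mul_of_nonneg_left (hA k x) K.coe_nonneg
    linarith
  rw [indexedRademacher, indexedRademacher, ← integral_const_mul]
  refine integral_mono ?_ ?_ fun z => ?_
  · exact (integrable_finsetSum _ fun σ _ => integrable_signedSup hn
      (fun k => hg.continuous.measurable.comp (hm k)) hgA σ _).const_mul _
  · exact ((integrable_finsetSum _ fun σ _ =>
      integrable_signedSup hn hm hA σ _).const_mul _).const_mul _
  · have := sum_iSup_contraction hφ n (fun k i => h k (z i)) (fun k i => hA k _) (fun _ => 0)
      (B := 0) (by simp)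
    simp only [zero_add] at this
    simp only [← Real.mul_iSup_of_nonneg K.coe_nonneg, ← Finset.mul_sum] at this
    simp only [signedSup, ← Real.mul_iSup_of_nonneg (show (0 : ℝ) ≤ 1 / n by positivity),
      ← Finset.mul_sum]
    calc (1 / 2 ^ n : ℝ) * (1 / n * ∑ σ : Fin n → ℤˣ, ⨆ k, ∑ i, ((σ i : ℤ) : ℝ) * g (h k (z i)))
        ≤ (1 / 2 ^ n : ℝ) * (1 / n *
          (K * ∑ σ : Fin n → ℤˣ, ⨆ k, ∑ i, ((σ i : ℤ) : ℝ) * h k (z i))) := by gcongr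
      _ = _ := by ring

/-- The supremum of an average is at most the average of the suprema, and each component of the
pairs is separately an i.i.d. sample from its marginal. The two components of a pair may be
dependent. -/
lemma indexedRademacher_pair_le {κ : Type*} [Countable κ] [Nonempty κ] {h : κ → X → ℝ}
    (hm : ∀ k, Measurable (h k)) {A : ℝ} (hA : ∀ k x, |h k x| ≤ A) {n : ℕ} (hn : 0 < n)
    (μ : Measure (X × X)) [IsProbabilityMeasure μ] :
    indexedRademacher (fun k (q : X × X) => (h k q.1 + h k q.2) / 2) n μ
      ≤ (indexedRademacher h n (μ.map Prod.fst) + indexedRademacher h n (μ.map Prod.snd)) / 2 := by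
  have hp1 : IsProbabilityMeasure (μ.map Prod.fst) :=
    Measure.isProbabilityMeasure_map measurable_fst.aemeasurable
  have hp2 : IsProbabilityMeasure (μ.map Prod.snd) :=
    Measure.isProbabilityMeasure_map measurable_snd.aemeasurable
  have hh : ∀ k, Measurable fun q : X × X => (h k q.1 + h k q.2) / 2 := fun k => by
    have := hm k
    fun_prop
  have hhA : ∀ k (q : X × X), |(h k q.1 + h k q.2) / 2| ≤ A := fun k q => by
    have h1 := abs_le.1 (hA k q.1)
    have h2 := abs_le.1 (hA k q.2)
    exact abs_le.2 ⟨by linarith, by linarith⟩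
  rw [indexedRademacher_eq hn hh hhA, indexedRademacher_eq hn hm hA, indexedRademacher_eq hn hm hA,
    ← mul_add, mul_div_assoc, ← Finset.sum_add_distrib, Finset.sum_div]
  refine mul_le_mul_of_nonneg_left (Finset.sum_le_sum fun σ _ => ?_) (by positivity)
  set W := Measure.pi fun _ : Fin n => μ
  have hfst : MeasurePreserving (fun (w : Fin n → X × X) i => (w i).1) W
      (Measure.pi fun _ => μ.map Prod.fst) :=
    measurePreserving_pi _ _ fun _ => ⟨measurable_fst, rfl⟩
  have hsnd : MeasurePreserving (fun (w : Fin n → X × X) i => (w i).2) W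
      (Measure.pi fun _ => μ.map Prod.snd) :=
    measurePreserving_pi _ _ fun _ => ⟨measurable_snd, rfl⟩
  have hi1 : Integrable (fun w : Fin n → X × X => signedSup h σ fun i => (w i).1) W :=
    hfst.integrable_comp_of_integrable (integrable_signedSup hn hm hA σ _)
  have hi2 : Integrable (fun w : Fin n → X × X => signedSup h σ fun i => (w i).2) W :=
    hsnd.integrable_comp_of_integrable (integrable_signedSup hn hm hA σ _)
  rw [← hfst.map_eq, ← hsnd.map_eq,
    integral_map hfst.aemeasurable (measurable_signedSup hm σ).aestronglyMeasurable,
    integral_map hsnd.aemeasurable (measurable_signedSup hm σ).aestronglyMeasurable,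
    ← integral_add hi1 hi2, ← integral_div]
  refine integral_mono (integrable_signedSup hn hh hhA σ W) ((hi1.add hi2).div_const 2)
    fun w => ciSup_le fun k => ?_
  have h1 := le_ciSup (bddAbove_range_of_abs_le (abs_signedMean_le hn hA σ fun i => (w i).1)) k
  have h2 := le_ciSup (bddAbove_range_of_abs_le (abs_signedMean_le hn hA σ fun i => (w i).2)) k
  refine le_trans (le_of_eq ?_) (div_le_div_of_nonneg_right (add_le_add h1 h2) zero_le_two)
  rw [← mul_add, ← Finset.sum_add_distrib, mul_div_assoc, Finset.sum_div]
  congr 1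
  exact Finset.sum_congr rfl fun i _ => by ring

/-- The class is pointwise measurable, bounded by `Cb`, and has Rademacher complexity at most
`CF / √n` for every law with a density with respect to `ν`. -/
structure ControlledClass (ν : Measure X) (F : Set (X → ℝ)) (Cb CF : ℝ) : Prop where
  nonempty : F.Nonempty
  pointwiseMeasurable : PointwiseMeasurable F
  abs_apply_le : ∀ f ∈ F, ∀ x, |f x| ≤ Cb
  rademacher_le : ∀ n : ℕ, 0 < n → ∀ μ : Measure X, IsProbabilityMeasure μ → μ ≪ ν →
    rademacher F n μ ≤ CF / √(n : ℝ)

/-- The radius of the uniform deviation bound for a `K`-Lipschitz function of oscillation `r`. -/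
noncomputable def deviationRadius (CF K r L : ℝ) (n : ℕ) : ℝ :=
  2 * (K * (CF / √(n : ℝ))) + r * √(L / (2 * n))

variable {ν : Measure X} {F : Set (X → ℝ)} {Cb CF : ℝ} {g : ℝ → ℝ} {K r : ℝ≥0}

lemma abs_comp_le_of_lipschitzWith (hg : LipschitzWith K g) {z : ℝ} (hz : |z| ≤ Cb) :
    |g z| ≤ |g 0| + K * Cb := by
  have h1 : |g z - g 0| ≤ K * |z - 0| := by simpa [Real.dist_eq] using hg.dist_le_mul z 0
  have h2 : |g z| ≤ |g z - g 0| + |g 0| := by simpa using abs_add_le (g z - g 0) (g 0)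
  have h3 : (K : ℝ) * |z - 0| ≤ K * Cb := by
    rw [sub_zero]
    exact mul_le_mul_of_nonneg_left hz K.coe_nonneg
  linarith

lemma ControlledClass.measure_pointMean_deviation_le (hF : ControlledClass ν F Cb CF)
    (hg : LipschitzWith K g) (hr : ∀ z z', |z| ≤ Cb → |z'| ≤ Cb → |g z - g z'| ≤ r)
    (μ : Measure X) [IsProbabilityMeasure μ] (hμ : μ ≪ ν) {n : ℕ} (hn : 0 < n) {L : ℝ}
    (hL : 0 ≤ L) :
    (Measure.pi fun _ : Fin n => μ) {z | ∃ f ∈ F, deviationRadius CF K r L n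
      < |∫ x, g (f x) ∂μ - pointMean z f g|} ≤ 2 * ENNReal.ofReal (Real.exp (-L)) := by
  obtain ⟨hmeas, F₀, hsub, hF₀, hlim⟩ := hF.pointwiseMeasurable
  have : Countable F₀ := hF₀
  have : Nonempty F₀ := by
    obtain ⟨f, hf⟩ := hF.nonempty
    obtain ⟨u, hu, -⟩ := hlim f hf
    exact ⟨⟨u 0, hu 0⟩⟩
  have hrad := hF.rademacher_le n hn μ inferInstance hμ
  rw [rademacher_eq_indexedRademacher hsub hF.nonempty hF.abs_apply_le hlim hn μ] at hrad
  have hcomp {g : ℝ → ℝ} (hg : LipschitzWith K g) :=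
    (indexedRademacher_comp_le (h := fun f : F₀ => (f : X → ℝ)) (fun f => hmeas f (hsub f.2))
      (fun f => hF.abs_apply_le f (hsub f.2)) hg hn μ).trans (mul_le_mul_of_nonneg_left hrad K.coe_nonneg)
  have hneg : indexedRademacher (fun f : F₀ => -fun x => g ((f : X → ℝ) x)) n μ
      ≤ K * (CF / √(n : ℝ)) := by
    have : (fun f : F₀ => -fun x => g ((f : X → ℝ) x)) = fun (f : F₀) x => (-g) ((f : X → ℝ) x) := rfl
    rw [this]
    exact hcomp (g := -g) hg.neg
  simp only [deviationRadius, pointMean]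
  exact measure_exists_abs_deviation_gt_le hF.nonempty hF₀ hlim (fun f x => g (f x))
    (fun f hf => hg.continuous.measurable.comp (hmeas f (hsub hf))) (B := |g 0| + K * Cb)
    (fun f hf x => abs_comp_le_of_lipschitzWith hg (hF.abs_apply_le f (hsub hf) x))
    (fun u f hu x => (hg.continuous.tendsto _).comp (hu x))
    (fun f hf x x' => hr _ _ (hF.abs_apply_le f (hsub hf) x) (hF.abs_apply_le f (hsub hf) x'))
    μ hn (hcomp hg) hneg hL

lemma ControlledClass.measure_pairMean_deviation_le (hF : ControlledClass ν F Cb CF)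
    (hg : LipschitzWith K g) (hr : ∀ z z', |z| ≤ Cb → |z'| ≤ Cb → |g z - g z'| ≤ r)
    (μ : Measure (X × X)) [IsProbabilityMeasure μ] (hμ₁ : μ.map Prod.fst ≪ ν)
    (hμ₂ : μ.map Prod.snd ≪ ν) {n : ℕ} (hn : 0 < n) {L : ℝ} (hL : 0 ≤ L) :
    (Measure.pi fun _ : Fin n => μ) {z | ∃ f ∈ F, deviationRadius CF K r L n
      < |∫ q, (g (f q.1) + g (f q.2)) / 2 ∂μ - pairMean z f g|}
        ≤ 2 * ENNReal.ofReal (Real.exp (-L)) := by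
  obtain ⟨hmeas, F₀, hsub, hF₀, hlim⟩ := hF.pointwiseMeasurable
  have : Countable F₀ := hF₀
  have : Nonempty F₀ := by
    obtain ⟨f, hf⟩ := hF.nonempty
    obtain ⟨u, hu, -⟩ := hlim f hf
    exact ⟨⟨u 0, hu 0⟩⟩
  have hp1 : IsProbabilityMeasure (μ.map Prod.fst) :=
    Measure.isProbabilityMeasure_map measurable_fst.aemeasurable
  have hp2 : IsProbabilityMeasure (μ.map Prod.snd) :=
    Measure.isProbabilityMeasure_map measurable_snd.aemeasurable
  have hrad₁ := hF.rademacher_le n hn _ hp1 hμ₁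
  have hrad₂ := hF.rademacher_le n hn _ hp2 hμ₂
  rw [rademacher_eq_indexedRademacher hsub hF.nonempty hF.abs_apply_le hlim hn] at hrad₁ hrad₂
  have hcomp {g : ℝ → ℝ} (hg : LipschitzWith K g) :
      indexedRademacher (fun (f : F₀) (q : X × X) => (g ((f : X → ℝ) q.1) + g ((f : X → ℝ) q.2)) / 2)
        n μ ≤ K * (CF / √(n : ℝ)) := by
    have h0 := indexedRademacher_pair_le (h := fun (f : F₀) x => g ((f : X → ℝ) x))
      (fun f => hg.continuous.measurable.comp (hmeas f (hsub f.2)))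
      (fun f x => abs_comp_le_of_lipschitzWith hg (hF.abs_apply_le f (hsub f.2) x)) hn μ
    have h1 := (indexedRademacher_comp_le (h := fun f : F₀ => (f : X → ℝ))
      (fun f => hmeas f (hsub f.2)) (fun f => hF.abs_apply_le f (hsub f.2)) hg hn
      (μ.map Prod.fst)).trans (mul_le_mul_of_nonneg_left hrad₁ K.coe_nonneg)
    have h2 := (indexedRademacher_comp_le (h := fun f : F₀ => (f : X → ℝ))
      (fun f => hmeas f (hsub f.2)) (fun f => hF.abs_apply_le f (hsub f.2)) hg hn
      (μ.map Prod.snd)).trans (mul_le_mul_of_nonneg_left hrad₂ K.coe_nonneg)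
    linarith
  obtain ⟨H, hH⟩ : ∃ H : (X → ℝ) → X × X → ℝ, ∀ f q, H f q = (g (f q.1) + g (f q.2)) / 2 :=
    ⟨_, fun _ _ => rfl⟩
  have hpos : indexedRademacher (fun f : F₀ => H f) n μ ≤ K * (CF / √(n : ℝ)) := by
    have : (fun f : F₀ => H f)
        = fun (f : F₀) (q : X × X) => (g ((f : X → ℝ) q.1) + g ((f : X → ℝ) q.2)) / 2 :=
      funext fun f => funext fun q => hH f q
    rw [this]
    exact hcomp hg
  have hneg : indexedRademacher (fun f : F₀ => -H f) n μ ≤ K * (CF / √(n : ℝ)) := by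
    have : (fun f : F₀ => -H f)
        = fun (f : F₀) (q : X × X) => ((-g) ((f : X → ℝ) q.1) + (-g) ((f : X → ℝ) q.2)) / 2 := by
      ext f q
      simp only [Pi.neg_apply, hH]
      ring
    rw [this]
    exact hcomp (g := -g) hg.neg
  have key := measure_exists_abs_deviation_gt_le hF.nonempty hF₀ hlim H (fun f hf => ?_)
    (B := |g 0| + K * Cb) (fun f hf q => ?_) (fun u f hu q => ?_) (r := r) (fun f hf q q' => ?_)
    μ hn hpos hneg hL
  · simpa only [deviationRadius, pairMean, ← hH] using key
  · rw [show H f = fun q => (g (f q.1) + g (f q.2)) / 2 from funext (hH f)]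
    have h1 := hg.continuous.measurable
    have h2 := hmeas f (hsub hf)
    fun_prop
  · rw [hH]
    have h1 := abs_le.1 (abs_comp_le_of_lipschitzWith hg (hF.abs_apply_le f (hsub hf) q.1))
    have h2 := abs_le.1 (abs_comp_le_of_lipschitzWith hg (hF.abs_apply_le f (hsub hf) q.2))
    exact abs_le.2 ⟨by linarith, by linarith⟩
  · simp only [hH]
    exact (((hg.continuous.tendsto _).comp (hu q.1)).add
      ((hg.continuous.tendsto _).comp (hu q.2))).div_const 2
  · rw [hH, hH]
    have h1 := abs_le.1 (hr _ _ (hF.abs_apply_le f (hsub hf) q.1) (hF.abs_apply_le f (hsub hf) q'.1))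
    have h2 := abs_le.1 (hr _ _ (hF.abs_apply_le f (hsub hf) q.2) (hF.abs_apply_le f (hsub hf) q'.2))
    exact abs_le.2 ⟨by linarith, by linarith⟩

/-- Listing the first and then the second components of `n` pairs of independent points yields
`n + n` independent points. -/
lemma measurePreserving_append_pairs (μ : Measure X) [IsProbabilityMeasure μ] (n : ℕ) :
    MeasurePreserving
      (fun (w : Fin n → X × X) => Fin.append (fun i => (w i).1) (fun i => (w i).2))
      (Measure.pi fun _ => μ.prod μ) (Measure.pi fun _ => μ) := by
  have hm : Measurable
      (fun (w : Fin n → X × X) => Fin.append (fun i => (w i).1) (fun i => (w i).2)) := by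
    refine measurable_pi_iff.2 fun j => ?_
    induction j using Fin.addCases with
    | left i => simp only [Fin.append_left]; fun_prop
    | right i => simp only [Fin.append_right]; fun_prop
  refine ⟨hm, (Measure.pi_eq fun s hs => ?_).symm⟩
  rw [Measure.map_apply hm (MeasurableSet.univ_pi hs)]
  have : (fun (w : Fin n → X × X) => Fin.append (fun i => (w i).1) (fun i => (w i).2)) ⁻¹'
      Set.univ.pi s = Set.univ.pi fun i => s (Fin.castAdd n i) ×ˢ s (Fin.natAdd n i) := by
    ext w
    simp only [Set.mem_preimage, Set.mem_univ_pi, Set.mem_prod]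
    constructor
    · exact fun h i => ⟨by simpa only [Fin.append_left] using h (Fin.castAdd n i),
        by simpa only [Fin.append_right] using h (Fin.natAdd n i)⟩
    · intro h j
      induction j using Fin.addCases with
      | left i => simpa only [Fin.append_left] using (h i).1
      | right i => simpa only [Fin.append_right] using (h i).2
  rw [this, Measure.pi_pi, Fin.prod_univ_add, ← Finset.prod_mul_distrib]
  simp

lemma ControlledClass.measure_pairMean_prod_deviation_le (hF : ControlledClass ν F Cb CF)
    (hg : LipschitzWith K g) (hr : ∀ z z', |z| ≤ Cb → |z'| ≤ Cb → |g z - g z'| ≤ r)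
    (μ : Measure X) [IsProbabilityMeasure μ] (hμ : μ ≪ ν) {n : ℕ} (hn : 0 < n) {L : ℝ}
    (hL : 0 ≤ L) :
    (Measure.pi fun _ : Fin n => μ.prod μ) {z | ∃ f ∈ F, deviationRadius CF K r L (n + n)
      < |∫ x, g (f x) ∂μ - pairMean z f g|} ≤ 2 * ENNReal.ofReal (Real.exp (-L)) := by
  have hmp := measurePreserving_append_pairs μ n
  refine le_trans ?_ (hF.measure_pointMean_deviation_le hg hr μ hμ (Nat.add_pos_left hn n) hL)
  rw [← hmp.map_eq]
  -- The exceptional set is a union over all of `F`, possibly not measurable; this inequality holds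
  -- for arbitrary sets.
  refine le_trans (le_of_eq ?_) (Measure.le_map_apply hmp.aemeasurable _)
  simp only [pairMean_eq_pointMean_append]
  rfl

end

/-! ### The laws of similar, dissimilar and unlabeled data -/

instance : MeasurableSingletonClass ℤˣ where
  measurableSet_singleton u := by
    have : ({u} : Set ℤˣ) = (fun v : ℤˣ => (v : ℤ)) ⁻¹' {(u : ℤ)} := by
      ext v
      simp [Units.ext_iff]
    rw [this]
    exact comap_measurable _ (measurableSet_singleton _)

lemma compl_label_one {X : Type*} : {q : X × ℤˣ | q.2 = 1}ᶜ = {q | q.2 = -1} := by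
  ext q
  rcases Int.units_eq_one_or q.2 with h | h <;> simp [h]

lemma sameLabel_eq_union {X : Type*} : sameLabel X
    = {q : X × ℤˣ | q.2 = 1} ×ˢ {q : X × ℤˣ | q.2 = 1}
      ∪ {q : X × ℤˣ | q.2 = -1} ×ˢ {q : X × ℤˣ | q.2 = -1} := by
  ext q
  rcases Int.units_eq_one_or q.1.2 with h | h <;> rcases Int.units_eq_one_or q.2.2 with h' | h' <;>
    simp [sameLabel, h, h']

lemma compl_sameLabel_eq_union {X : Type*} : (sameLabel X)ᶜ
    = {q : X × ℤˣ | q.2 = 1} ×ˢ {q : X × ℤˣ | q.2 = -1}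
      ∪ {q : X × ℤˣ | q.2 = -1} ×ˢ {q : X × ℤˣ | q.2 = 1} := by
  ext q
  rcases Int.units_eq_one_or q.1.2 with h | h <;> rcases Int.units_eq_one_or q.2.2 with h' | h' <;>
    simp [sameLabel, h, h']

lemma disjoint_label_prod {X : Type*} (s t : ℤˣ) :
    Disjoint ({q : X × ℤˣ | q.2 = 1} ×ˢ {q : X × ℤˣ | q.2 = s})
      ({q : X × ℤˣ | q.2 = -1} ×ˢ {q : X × ℤˣ | q.2 = t}) := by
  refine Set.disjoint_left.2 fun q h h' => ?_
  have h1 : q.1.2 = 1 := h.1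
  have h2 : q.1.2 = -1 := h'.1
  rw [h1] at h2
  exact absurd h2 (by decide)

section

variable {X : Type*} [MeasurableSpace X] (P : Measure (X × ℤˣ))

/-- The integral of `φ` over the examples with label `t`. -/
noncomputable def classIntegral (t : ℤˣ) (φ : X → ℝ) : ℝ :=
  ∫ q in {q : X × ℤˣ | q.2 = t}, φ q.1 ∂P

lemma measurableSet_label (t : ℤˣ) : MeasurableSet {q : X × ℤˣ | q.2 = t} :=
  measurable_snd (measurableSet_singleton t)

lemma prior_nonneg (t : ℤˣ) : 0 ≤ prior P t := measureReal_nonneg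

lemma simProp_nonneg : 0 ≤ simProp P := measureReal_nonneg

lemma disProp_nonneg : 0 ≤ disProp P := measureReal_nonneg

variable [IsProbabilityMeasure P]

lemma prior_add_prior : prior P 1 + prior P (-1) = 1 := by
  rw [prior, prior, ← compl_label_one, measureReal_add_measureReal_compl (measurableSet_label 1)]
  simp

lemma integral_eq_classIntegral_add {ψ : X → ℤˣ → ℝ} (hψ : ∀ t, Measurable fun x => ψ x t)
    {B : ℝ} (hB : ∀ x t, |ψ x t| ≤ B) :
    ∫ q, ψ q.1 q.2 ∂P
      = classIntegral P 1 (fun x => ψ x 1) + classIntegral P (-1) fun x => ψ x (-1) := by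
  have hm : Measurable fun q : X × ℤˣ => ψ q.1 q.2 := measurable_from_prod_countable_left hψ
  have hint : Integrable (fun q : X × ℤˣ => ψ q.1 q.2) P :=
    Integrable.of_bound hm.aestronglyMeasurable B (.of_forall fun q => hB _ _)
  rw [← integral_add_compl (measurableSet_label 1) hint, compl_label_one, classIntegral,
    classIntegral]
  congr 1 <;> refine setIntegral_congr_fun (measurableSet_label _) fun q hq => ?_
  · simp only [Set.mem_ofPred_eq] at hq
    simp only [hq]
  · simp only [Set.mem_ofPred_eq] at hq
    simp only [hq]

lemma classIntegral_add {t : ℤˣ} {φ ψ : X → ℝ} (hφ : Measurable φ) (hψ : Measurable ψ) {B : ℝ}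
    (hφB : ∀ x, |φ x| ≤ B) (hψB : ∀ x, |ψ x| ≤ B) (a b : ℝ) :
    classIntegral P t (fun x => a * φ x + b * ψ x)
      = a * classIntegral P t φ + b * classIntegral P t ψ := by
  have h {φ : X → ℝ} (hφ : Measurable φ) (hB : ∀ x, |φ x| ≤ B) :
      Integrable (fun q => φ q.1) (P.restrict {q : X × ℤˣ | q.2 = t}) :=
    Integrable.of_bound (hφ.comp measurable_fst).aestronglyMeasurable B (.of_forall fun q => hB _)
  rw [classIntegral, integral_add ((h hφ hφB).const_mul a) ((h hψ hψB).const_mul b),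
    integral_const_mul, integral_const_mul]
  rfl

lemma integral_unlabeledLaw {φ : X → ℝ} (hφ : Measurable φ) {B : ℝ} (hB : ∀ x, |φ x| ≤ B) :
    ∫ x, φ x ∂(unlabeledLaw P) = classIntegral P 1 φ + classIntegral P (-1) φ := by
  rw [unlabeledLaw, integral_map measurable_fst.aemeasurable hφ.aestronglyMeasurable]
  exact integral_eq_classIntegral_add P (ψ := fun x _ => φ x) (fun _ => hφ) fun x _ => hB x

lemma setIntegral_label_prod_fst (s t : ℤˣ) (φ : X → ℝ) :
    ∫ q in {q : X × ℤˣ | q.2 = s} ×ˢ {q : X × ℤˣ | q.2 = t}, φ q.1.1 ∂(P.prod P)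
      = prior P t * classIntegral P s φ := by
  rw [← Measure.prod_restrict, integral_fun_fst fun q : X × ℤˣ => φ q.1]
  simp [prior, classIntegral]

lemma setIntegral_label_prod_snd (s t : ℤˣ) (φ : X → ℝ) :
    ∫ q in {q : X × ℤˣ | q.2 = s} ×ˢ {q : X × ℤˣ | q.2 = t}, φ q.2.1 ∂(P.prod P)
      = prior P s * classIntegral P t φ := by
  rw [← Measure.prod_restrict, integral_fun_snd fun q : X × ℤˣ => φ q.1]
  simp [prior, classIntegral]

/-- Multiplying by the mass rather than dividing by it keeps the identity valid for null events,
where both sides are zero. -/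
lemma measureReal_mul_integral_cond {Y : Type*} [MeasurableSpace Y] (μ : Measure Y)
    [IsFiniteMeasure μ] (s : Set Y) (f : Y → ℝ) :
    μ.real s * ∫ y, f y ∂(μ[|s]) = ∫ y in s, f y ∂μ := by
  rw [ProbabilityTheory.cond, integral_smul_measure, smul_eq_mul, ENNReal.toReal_inv, ← mul_assoc]
  by_cases h : μ s = 0
  · simp [Measure.restrict_eq_zero.2 h]
  · rw [Measure.real, mul_inv_cancel₀ (ENNReal.toReal_ne_zero.2 ⟨h, measure_ne_top μ s⟩), one_mul]

lemma integrable_of_abs_le {Y : Type*} [MeasurableSpace Y] {μ : Measure Y} [IsFiniteMeasure μ]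
    {f : Y → ℝ} (hf : Measurable f) {B : ℝ} (hB : ∀ y, |f y| ≤ B) : Integrable f μ :=
  Integrable.of_bound hf.aestronglyMeasurable B (.of_forall hB)

/-- The event `y = y'` is a disjoint union of two label rectangles. On each one the integral factors
into a class integral and the prior of the label of the unused example. -/
lemma simProp_mul_integral_fst {φ : X → ℝ} (hφ : Measurable φ) {B : ℝ} (hB : ∀ x, |φ x| ≤ B) :
    simProp P * ∫ q, φ q.1 ∂(simPairLaw P)
      = prior P 1 * classIntegral P 1 φ + prior P (-1) * classIntegral P (-1) φ := by
  have hm : Measurable fun q : (X × ℤˣ) × (X × ℤˣ) => φ q.1.1 := by fun_prop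
  rw [simPairLaw, integral_map (by fun_prop) (Measurable.aestronglyMeasurable (by fun_prop)), simProp, measureReal_mul_integral_cond,
    sameLabel_eq_union, setIntegral_union (disjoint_label_prod _ _)
      ((measurableSet_label _).prod (measurableSet_label _))
      (integrable_of_abs_le hm fun _ => hB _) (integrable_of_abs_le hm fun _ => hB _),
    setIntegral_label_prod_fst, setIntegral_label_prod_fst]

lemma simProp_mul_integral_snd {φ : X → ℝ} (hφ : Measurable φ) {B : ℝ} (hB : ∀ x, |φ x| ≤ B) :
    simProp P * ∫ q, φ q.2 ∂(simPairLaw P)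
      = prior P 1 * classIntegral P 1 φ + prior P (-1) * classIntegral P (-1) φ := by
  have hm : Measurable fun q : (X × ℤˣ) × (X × ℤˣ) => φ q.2.1 := by fun_prop
  rw [simPairLaw, integral_map (by fun_prop) (Measurable.aestronglyMeasurable (by fun_prop)), simProp, measureReal_mul_integral_cond,
    sameLabel_eq_union, setIntegral_union (disjoint_label_prod _ _)
      ((measurableSet_label _).prod (measurableSet_label _))
      (integrable_of_abs_le hm fun _ => hB _) (integrable_of_abs_le hm fun _ => hB _),
    setIntegral_label_prod_snd, setIntegral_label_prod_snd]

lemma disProp_mul_integral_fst {φ : X → ℝ} (hφ : Measurable φ) {B : ℝ} (hB : ∀ x, |φ x| ≤ B) :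
    disProp P * ∫ q, φ q.1 ∂(disPairLaw P)
      = prior P (-1) * classIntegral P 1 φ + prior P 1 * classIntegral P (-1) φ := by
  have hm : Measurable fun q : (X × ℤˣ) × (X × ℤˣ) => φ q.1.1 := by fun_prop
  rw [disPairLaw, integral_map (by fun_prop) (Measurable.aestronglyMeasurable (by fun_prop)), disProp, measureReal_mul_integral_cond,
    compl_sameLabel_eq_union, setIntegral_union (disjoint_label_prod _ _)
      ((measurableSet_label _).prod (measurableSet_label _))
      (integrable_of_abs_le hm fun _ => hB _) (integrable_of_abs_le hm fun _ => hB _),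
    setIntegral_label_prod_fst, setIntegral_label_prod_fst]

lemma disProp_mul_integral_snd {φ : X → ℝ} (hφ : Measurable φ) {B : ℝ} (hB : ∀ x, |φ x| ≤ B) :
    disProp P * ∫ q, φ q.2 ∂(disPairLaw P)
      = prior P (-1) * classIntegral P 1 φ + prior P 1 * classIntegral P (-1) φ := by
  have hm : Measurable fun q : (X × ℤˣ) × (X × ℤˣ) => φ q.2.1 := by fun_prop
  rw [disPairLaw, integral_map (by fun_prop) (Measurable.aestronglyMeasurable (by fun_prop)), disProp, measureReal_mul_integral_cond,
    compl_sameLabel_eq_union, setIntegral_union (disjoint_label_prod _ _)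
      ((measurableSet_label _).prod (measurableSet_label _))
      (integrable_of_abs_le hm fun _ => hB _) (integrable_of_abs_le hm fun _ => hB _),
    setIntegral_label_prod_snd, setIntegral_label_prod_snd, add_comm]

instance : IsZeroOrProbabilityMeasure (simPairLaw P) := by
  unfold simPairLaw; infer_instance

instance : IsZeroOrProbabilityMeasure (disPairLaw P) := by
  unfold disPairLaw; infer_instance

instance : IsZeroOrProbabilityMeasure (simPointLaw P) := by
  unfold simPointLaw; infer_instance

instance : IsZeroOrProbabilityMeasure (disPointLaw P) := by
  unfold disPointLaw; infer_instance

lemma simProp_mul_integral_pair {φ : X → ℝ} (hφ : Measurable φ) {B : ℝ} (hB : ∀ x, |φ x| ≤ B) :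
    simProp P * ∫ q, (φ q.1 + φ q.2) / 2 ∂(simPairLaw P)
      = prior P 1 * classIntegral P 1 φ + prior P (-1) * classIntegral P (-1) φ := by
  have h1 : Integrable (fun q : X × X => φ q.1) (simPairLaw P) :=
    integrable_of_abs_le (hφ.comp measurable_fst) fun _ => hB _
  have h2 : Integrable (fun q : X × X => φ q.2) (simPairLaw P) :=
    integrable_of_abs_le (hφ.comp measurable_snd) fun _ => hB _
  rw [integral_div, integral_add h1 h2]
  linarith [simProp_mul_integral_fst P hφ hB, simProp_mul_integral_snd P hφ hB]

lemma disProp_mul_integral_pair {φ : X → ℝ} (hφ : Measurable φ) {B : ℝ} (hB : ∀ x, |φ x| ≤ B) :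
    disProp P * ∫ q, (φ q.1 + φ q.2) / 2 ∂(disPairLaw P)
      = prior P (-1) * classIntegral P 1 φ + prior P 1 * classIntegral P (-1) φ := by
  have h1 : Integrable (fun q : X × X => φ q.1) (disPairLaw P) :=
    integrable_of_abs_le (hφ.comp measurable_fst) fun _ => hB _
  have h2 : Integrable (fun q : X × X => φ q.2) (disPairLaw P) :=
    integrable_of_abs_le (hφ.comp measurable_snd) fun _ => hB _
  rw [integral_div, integral_add h1 h2]
  linarith [disProp_mul_integral_fst P hφ hB, disProp_mul_integral_snd P hφ hB]

lemma simProp_mul_integral_point {φ : X → ℝ} (hφ : Measurable φ) {B : ℝ} (hB : ∀ x, |φ x| ≤ B) :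
    simProp P * ∫ x, φ x ∂(simPointLaw P)
      = prior P 1 * classIntegral P 1 φ + prior P (-1) * classIntegral P (-1) φ := by
  rw [simPointLaw, integral_map measurable_fst.aemeasurable hφ.aestronglyMeasurable]
  exact simProp_mul_integral_fst P hφ hB

lemma disProp_mul_integral_point {φ : X → ℝ} (hφ : Measurable φ) {B : ℝ} (hB : ∀ x, |φ x| ≤ B) :
    disProp P * ∫ x, φ x ∂(disPointLaw P)
      = prior P (-1) * classIntegral P 1 φ + prior P 1 * classIntegral P (-1) φ := by
  rw [disPointLaw, integral_map measurable_fst.aemeasurable hφ.aestronglyMeasurable]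
  exact disProp_mul_integral_fst P hφ hB

/-- Conditioning creates no new null-set violations, so the point laws inherit a density from the
unlabeled law and the complexity bound applies to them. -/
lemma map_fst_cond_absolutelyContinuous (s : Set ((X × ℤˣ) × (X × ℤˣ))) :
    (((P.prod P)[|s]).map fun q => (q.1.1, q.2.1)).map Prod.fst ≪ unlabeledLaw P := by
  rw [Measure.map_map measurable_fst (by fun_prop)]
  have h := (cond_absolutelyContinuous (μ := P.prod P) (s := s)).map
    (f := fun q => q.1.1) (by fun_prop)
  have h' : (P.prod P).map (fun q => q.1.1) = unlabeledLaw P := by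
    conv_rhs => rw [unlabeledLaw, ← (measurePreserving_fst (μ := P) (ν := P)).map_eq,
      Measure.map_map measurable_fst measurable_fst]
    rfl
  rwa [h'] at h

lemma map_snd_cond_absolutelyContinuous (s : Set ((X × ℤˣ) × (X × ℤˣ))) :
    (((P.prod P)[|s]).map fun q => (q.1.1, q.2.1)).map Prod.snd ≪ unlabeledLaw P := by
  rw [Measure.map_map measurable_snd (by fun_prop)]
  have h := (cond_absolutelyContinuous (μ := P.prod P) (s := s)).map
    (f := fun q => q.2.1) (by fun_prop)
  have h' : (P.prod P).map (fun q => q.2.1) = unlabeledLaw P := by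
    conv_rhs => rw [unlabeledLaw, ← (measurePreserving_snd (μ := P) (ν := P)).map_eq,
      Measure.map_map measurable_fst measurable_snd]
    rfl
  rwa [h'] at h

/-! ### Unbiasedness of the combined empirical risk -/

/-- The combination `a ℓ(z, +1) + b ℓ(z, -1)`. -/
noncomputable def combLoss (l : ℝ → ℤˣ → ℝ) (a b z : ℝ) : ℝ := a * l z 1 + b * l z (-1)

end

section

variable {l : ℝ → ℤˣ → ℝ}

lemma lipschitzWith_combLoss {ρ : ℝ≥0} (hl : ∀ t, LipschitzWith ρ fun z => l z t) (a b : ℝ) :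
    LipschitzWith ((‖a‖₊ + ‖b‖₊) * ρ) (combLoss l a b) := by
  refine LipschitzWith.of_dist_le_mul fun z z' => ?_
  have h (t : ℤˣ) := (hl t).dist_le_mul z z'
  simp only [Real.dist_eq] at h ⊢
  push_cast
  simp only [Real.norm_eq_abs]
  calc |combLoss l a b z - combLoss l a b z'|
      = |a * (l z 1 - l z' 1) + b * (l z (-1) - l z' (-1))| := by
        congr 1; simp only [combLoss]; ring
    _ ≤ |a| * |l z 1 - l z' 1| + |b| * |l z (-1) - l z' (-1)| := by
        rw [← abs_mul, ← abs_mul]; exact abs_add_le _ _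
    _ ≤ |a| * (ρ * |z - z'|) + |b| * (ρ * |z - z'|) := by gcongr <;> exact h _
    _ = _ := by ring

lemma le_lossSup {ρ : ℝ≥0} (hl : ∀ t, LipschitzWith ρ fun z => l z t) {Cb z : ℝ} (hz : |z| ≤ Cb)
    (t : ℤˣ) : l z t ≤ lossSup l Cb := by
  refine le_ciSup (f := fun q : Set.Icc (-Cb) Cb × ℤˣ => l q.1 q.2) ?_ (⟨z, abs_le.1 hz⟩, t)
  refine ⟨|l 0 1| + |l 0 (-1)| + ρ * Cb, ?_⟩
  rintro _ ⟨⟨⟨y, hy⟩, s⟩, rfl⟩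
  have h := abs_comp_le_of_lipschitzWith (hl s) (abs_le.2 hy)
  have h' : |l 0 s| ≤ |l 0 1| + |l 0 (-1)| := by
    rcases Int.units_eq_one_or s with rfl | rfl <;> simp
  exact (le_abs_self _).trans (h.trans (by linarith))

/-- Since the loss takes values in `[0, C_ℓ]`, its oscillation is at most `C_ℓ` rather than `2 C_ℓ`.
-/
lemma abs_combLoss_sub_le (h0 : ∀ z t, 0 ≤ l z t) {ρ : ℝ≥0}
    (hl : ∀ t, LipschitzWith ρ fun z => l z t) {Cb : ℝ} (a b : ℝ) {z z' : ℝ} (hz : |z| ≤ Cb)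
    (hz' : |z'| ≤ Cb) :
    |combLoss l a b z - combLoss l a b z'| ≤ (|a| + |b|) * lossSup l Cb := by
  have h (t : ℤˣ) : |l z t - l z' t| ≤ lossSup l Cb := abs_le.2
    ⟨by linarith [h0 z t, le_lossSup hl hz' t], by linarith [h0 z' t, le_lossSup hl hz t]⟩
  calc |combLoss l a b z - combLoss l a b z'|
      = |a * (l z 1 - l z' 1) + b * (l z (-1) - l z' (-1))| := by
        congr 1; simp only [combLoss]; ring
    _ ≤ |a| * |l z 1 - l z' 1| + |b| * |l z (-1) - l z' (-1)| := by
        rw [← abs_mul, ← abs_mul]; exact abs_add_le _ _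
    _ ≤ |a| * lossSup l Cb + |b| * lossSup l Cb := by gcongr <;> exact h _
    _ = _ := by ring

lemma pairMean_combLoss {X : Type*} {n : ℕ} (xs : Fin n → X × X) (f : X → ℝ) (a b : ℝ) :
    pairMean xs f (combLoss l a b)
      = a * pairMean xs f (fun z => l z 1) + b * pairMean xs f (fun z => l z (-1)) := by
  simp only [pairMean, combLoss, Finset.mul_sum, ← Finset.sum_add_distrib]
  exact Finset.sum_congr rfl fun i _ => by ring

lemma pointMean_combLoss {X : Type*} {n : ℕ} (xs : Fin n → X) (f : X → ℝ) (a b : ℝ) :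
    pointMean xs f (combLoss l a b)
      = a * pointMean xs f (fun z => l z 1) + b * pointMean xs f (fun z => l z (-1)) := by
  simp only [pointMean, combLoss, Finset.mul_sum, ← Finset.sum_add_distrib]
  exact Finset.sum_congr rfl fun i _ => by ring

variable {X : Type*} [MeasurableSpace X] (P : Measure (X × ℤˣ)) (l)

/-- The loss applied to similar data by the combined empirical risk. -/
noncomputable def simLoss (γ₁ γ₃ : ℝ) : ℝ → ℝ :=
  combLoss l ((γ₁ + γ₃ * prior P 1) / (prior P 1 - prior P (-1)))
    (-(γ₁ + γ₃ * prior P (-1)) / (prior P 1 - prior P (-1)))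

/-- The loss applied to dissimilar data by the combined empirical risk. -/
noncomputable def disLoss (γ₂ γ₃ : ℝ) : ℝ → ℝ :=
  combLoss l (-(γ₂ + γ₃ * prior P (-1)) / (prior P 1 - prior P (-1)))
    ((γ₂ + γ₃ * prior P 1) / (prior P 1 - prior P (-1)))

/-- The loss applied to unlabeled data by the combined empirical risk. -/
noncomputable def unlabeledLoss (γ₁ γ₂ : ℝ) : ℝ → ℝ :=
  combLoss l ((γ₂ * prior P 1 - γ₁ * prior P (-1)) / (prior P 1 - prior P (-1)))
    ((γ₁ * prior P 1 - γ₂ * prior P (-1)) / (prior P 1 - prior P (-1)))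

/-- Collecting the coefficients by data source lets each source be handled by a single uniform
deviation, instead of one for each of the three risks. -/
lemma empSDU_eq (γ₁ γ₂ γ₃ : ℝ) {nS nD nU : ℕ} (xS : Fin nS → X × X) (xD : Fin nD → X × X)
    (xU : Fin nU → X) (f : X → ℝ) :
    empSDU P l γ₁ γ₂ γ₃ xS xD xU f = simProp P * pairMean xS f (simLoss l P γ₁ γ₃)
      + disProp P * pairMean xD f (disLoss l P γ₂ γ₃) + pointMean xU f (unlabeledLoss l P γ₁ γ₂) := by
  have h1 : diffLoss P l = combLoss l (1 / (prior P 1 - prior P (-1)))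
      (-1 / (prior P 1 - prior P (-1))) := by
    ext z; simp only [diffLoss, combLoss]; ring
  have h2 : (fun z => -combLoss l (1 / (prior P 1 - prior P (-1)))
      (-1 / (prior P 1 - prior P (-1))) z) = combLoss l (-1 / (prior P 1 - prior P (-1)))
      (1 / (prior P 1 - prior P (-1))) := by
    ext z; simp only [combLoss]; ring
  have h3 : (fun z => corrLoss P l z 1) = combLoss l (prior P 1 / (prior P 1 - prior P (-1)))
      (-prior P (-1) / (prior P 1 - prior P (-1))) := by
    ext z; simp only [corrLoss, combLoss]; ring
  have h4 : (fun z => corrLoss P l z (-1)) = combLoss l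
      (-prior P (-1) / (prior P 1 - prior P (-1))) (prior P 1 / (prior P 1 - prior P (-1))) := by
    ext z; simp only [corrLoss, combLoss, neg_neg]; ring
  simp only [empSDU, empSU, empDU, empSD, simLoss, disLoss, unlabeledLoss, h1, h2, h3, h4,
    pairMean_combLoss, pointMean_combLoss]
  ring

/-- The combined risk is unbiased: it is determined by the integrals over the two classes. -/
lemma risk_eq [IsProbabilityMeasure P] (hπ : prior P 1 ≠ prior P (-1)) {γ₁ γ₂ γ₃ : ℝ}
    (hγ : γ₁ + γ₂ + γ₃ = 1) {f : X → ℝ} (hl : ∀ t, Measurable fun x => l (f x) t) {B : ℝ}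
    (hB : ∀ x t, |l (f x) t| ≤ B) {eS eD eU : ℝ}
    (hS : eS = prior P 1 * classIntegral P 1 (fun x => simLoss l P γ₁ γ₃ (f x))
      + prior P (-1) * classIntegral P (-1) fun x => simLoss l P γ₁ γ₃ (f x))
    (hD : eD = prior P (-1) * classIntegral P 1 (fun x => disLoss l P γ₂ γ₃ (f x))
      + prior P 1 * classIntegral P (-1) fun x => disLoss l P γ₂ γ₃ (f x))
    (hU : eU = classIntegral P 1 (fun x => unlabeledLoss l P γ₁ γ₂ (f x))
      + classIntegral P (-1) fun x => unlabeledLoss l P γ₁ γ₂ (f x)) :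
    risk P l f = eS + eD + eU := by
  have hcomb (t : ℤˣ) (a b : ℝ) : classIntegral P t (fun x => combLoss l a b (f x))
      = a * classIntegral P t (fun x => l (f x) 1) + b * classIntegral P t fun x => l (f x) (-1) :=
    classIntegral_add P (hl 1) (hl (-1)) (fun x => hB x 1) (fun x => hB x (-1)) a b
  have hr : risk P l f = classIntegral P 1 (fun x => l (f x) 1)
      + classIntegral P (-1) fun x => l (f x) (-1) :=
    integral_eq_classIntegral_add P (ψ := fun x t => l (f x) t) hl hB
  rw [hr, hS, hD, hU]
  simp only [simLoss, disLoss, unlabeledLoss, hcomb]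
  have hΔ : prior P 1 - prior P (-1) ≠ 0 := sub_ne_zero.2 hπ
  have hsum := prior_add_prior P
  -- Eliminating `γ₃` and `π₋` leaves a rational identity, linear in the class integrals, whose
  -- denominator is `π₊ - π₋`.
  obtain rfl : γ₃ = 1 - γ₁ - γ₂ := by linarith
  generalize prior P 1 = p at *
  generalize prior P (-1) = m at *
  obtain rfl : m = 1 - p := by linarith
  field_simp
  ring

end

/-! ### The excess risk bound -/

section

/-- An inequality is enough for tail bounds and, unlike equality, needs no measurability of `B`. -/
lemma IsIID.measure_mem_le {Ω E : Type*} [MeasurableSpace Ω] [MeasurableSpace E] {Pr : Measure Ω}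
    [IsProbabilityMeasure Pr] {n : ℕ} {Z : Fin n → Ω → E} {Q : Measure E} (hZ : IsIID Pr Z Q)
    (B : Set (Fin n → E)) :
    Pr {ω | (fun i => Z i ω) ∈ B} ≤ (Measure.pi fun _ : Fin n => Q) B := by
  have hae : ∀ i, AEMeasurable (Z i) Pr := fun i => (hZ.2 i).aemeasurable
  have hmap := (iIndepFun_iff_map_fun_eq_pi_map hae).1 hZ.1
  simp only [(hZ.2 _).map_eq] at hmap
  rw [← hmap]
  exact Measure.le_map_apply (aemeasurable_pi_lambda _ hae) B

lemma IsIID.isProbabilityMeasure {Ω E : Type*} [MeasurableSpace Ω] [MeasurableSpace E]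
    {Pr : Measure Ω} [IsProbabilityMeasure Pr] {n : ℕ} (hn : 0 < n) {Z : Fin n → Ω → E}
    {Q : Measure E} (hZ : IsIID Pr Z Q) : IsProbabilityMeasure Q :=
  (hZ.2 ⟨0, hn⟩).isProbabilityMeasure_iff.1 inferInstance

lemma isProbabilityMeasure_of_prod_self {E : Type*} [MeasurableSpace E] {Q : Measure E}
    [IsZeroOrProbabilityMeasure Q] (h : IsProbabilityMeasure (Q.prod Q)) :
    IsProbabilityMeasure Q := by
  rcases eq_zero_or_isProbabilityMeasure Q with rfl | hQ
  · simpa using h.measure_univ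
  · exact hQ

/-- A minimizer of the empirical risk has small excess risk as soon as its three parts are
uniformly close to their expectations. -/
lemma measure_excess_gt_le {X Ω : Type*} [MeasurableSpace Ω] (Pr : Measure Ω) {F : Set (X → ℝ)}
    {R ES ED EU : (X → ℝ) → ℝ} {Rhat MS MD MU : Ω → (X → ℝ) → ℝ} {a b rS rD rU : ℝ}
    (ha : 0 ≤ a) (hb : 0 ≤ b) (hR : ∀ f ∈ F, R f = a * ES f + b * ED f + EU f)
    (hRhat : ∀ ω f, Rhat ω f = a * MS ω f + b * MD ω f + MU ω f) {fstar : X → ℝ}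
    (hfstar : fstar ∈ F) {fhat : Ω → X → ℝ}
    (hfhat : ∀ᵐ ω ∂Pr, fhat ω ∈ F ∧ IsMinOn (Rhat ω) F (fhat ω)) {η : ℝ≥0∞}
    (hS : Pr {ω | ∃ f ∈ F, rS < |ES f - MS ω f|} ≤ η)
    (hD : Pr {ω | ∃ f ∈ F, rD < |ED f - MD ω f|} ≤ η)
    (hU : Pr {ω | ∃ f ∈ F, rU < |EU f - MU ω f|} ≤ η) :
    Pr {ω | ¬ (R (fhat ω) - R fstar ≤ 2 * (a * rS + b * rD + rU))} ≤ η + η + η := by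
  -- Outside a null set, a failure of the bound puts `ω` in one of the three deviation events; no
  -- measurability of `fhat` is needed.
  refine le_trans (measure_mono_ae ?_) ((measure_union_le _ _).trans
    (add_le_add ((measure_union_le _ _).trans (add_le_add hS hD)) hU))
  filter_upwards [hfhat] with ω hω hbad
  by_contra hgood
  refine hbad ?_
  obtain ⟨hmem, hmin⟩ := hω
  have hg : (∀ f ∈ F, |ES f - MS ω f| ≤ rS) ∧ (∀ f ∈ F, |ED f - MD ω f| ≤ rD) ∧
      ∀ f ∈ F, |EU f - MU ω f| ≤ rU := by
    refine ⟨fun f hf => ?_, fun f hf => ?_, fun f hf => ?_⟩ <;> by_contra! h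
    · exact hgood (Or.inl (Or.inl ⟨f, hf, h⟩))
    · exact hgood (Or.inl (Or.inr ⟨f, hf, h⟩))
    · exact hgood (Or.inr ⟨f, hf, h⟩)
  obtain ⟨hgS, hgD, hgU⟩ := hg
  have hle : Rhat ω (fhat ω) ≤ Rhat ω fstar := hmin hfstar
  rw [hRhat, hRhat] at hle
  rw [hR _ hmem, hR _ hfstar]
  -- The excess risk is at most the deviation at `fhat ω` plus the reverse deviation at `fstar`,
  -- because the empirical risks compare favourably. Each costs one radius, whence the factor `2`.
  have h1 := mul_le_mul_of_nonneg_left (abs_le.1 (hgS _ hmem)).2 ha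
  have h2 := mul_le_mul_of_nonneg_left (abs_le.1 (hgD _ hmem)).2 hb
  have h3 := (abs_le.1 (hgU _ hmem)).2
  have h4 := mul_le_mul_of_nonneg_left (abs_le.1 (hgS _ hfstar)).1 ha
  have h5 := mul_le_mul_of_nonneg_left (abs_le.1 (hgD _ hfstar)).1 hb
  have h6 := (abs_le.1 (hgU _ hfstar)).1
  linarith

lemma two_mul_deviationRadius {CF w ρ Cl L : ℝ} (hCl : 0 ≤ Cl) {n : ℕ} :
    2 * deviationRadius CF (w * ρ) (w * Cl) L n
      = w * (4 * ρ * CF + √(2 * Cl ^ 2 * L)) / √(n : ℝ) := by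
  have h : 2 * Cl * √(L / (2 * n)) = √(2 * Cl ^ 2 * L) / √(n : ℝ) := by
    rw [← Real.sqrt_div' _ (Nat.cast_nonneg n),
      show 2 * Cl ^ 2 * L / n = (2 * Cl) ^ 2 * (L / (2 * n)) by ring,
      Real.sqrt_mul (sq_nonneg _), Real.sqrt_sq (by positivity)]
  have h' : 2 * deviationRadius CF (w * ρ) (w * Cl) L n
      = w * (4 * ρ * (CF / √(n : ℝ))) + w * (2 * Cl * √(L / (2 * n))) := by
    rw [deviationRadius]
    ring
  rw [h', h]
  ring

variable {X : Type*} [MeasurableSpace X] (P : Measure (X × ℤˣ)) (l : ℝ → ℤˣ → ℝ)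

/-- The deviation radius of the loss `combLoss l a b`. -/
noncomputable def combRadius (l : ℝ → ℤˣ → ℝ) (ρ Cb CF L a b : ℝ) (n : ℕ) : ℝ :=
  deviationRadius CF ((|a| + |b|) * ρ) ((|a| + |b|) * lossSup l Cb) L n

/-- The priors sum to one, so the two `γ₃` terms add up to `γ₃`. With `γ₂` for `γ₁` and the summands
exchanged, the same computation serves the dissimilar loss. -/
lemma abs_simLoss_coeff [IsProbabilityMeasure P] {γ₁ γ₃ : ℝ} (hγ₁ : 0 ≤ γ₁) (hγ₃ : 0 ≤ γ₃) :
    |(γ₁ + γ₃ * prior P 1) / (prior P 1 - prior P (-1))|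
      + |-(γ₁ + γ₃ * prior P (-1)) / (prior P 1 - prior P (-1))|
      = (2 * γ₁ + γ₃) / |prior P 1 - prior P (-1)| := by
  have h1 := prior_nonneg P 1
  have h2 := prior_nonneg P (-1)
  rw [abs_div, abs_div, abs_neg, abs_of_nonneg (by positivity : 0 ≤ γ₁ + γ₃ * prior P 1),
    abs_of_nonneg (by positivity : 0 ≤ γ₁ + γ₃ * prior P (-1)), ← add_div]
  congr 1
  linear_combination γ₃ * prior_add_prior P

lemma abs_unlabeledLoss_coeff (γ₁ γ₂ : ℝ) :
    |(γ₂ * prior P 1 - γ₁ * prior P (-1)) / (prior P 1 - prior P (-1))|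
      + |(γ₁ * prior P 1 - γ₂ * prior P (-1)) / (prior P 1 - prior P (-1))|
      = (|γ₁ * prior P (-1) - γ₂ * prior P 1| + |γ₁ * prior P 1 - γ₂ * prior P (-1)|)
        / |prior P 1 - prior P (-1)| := by
  rw [abs_div, abs_div, ← add_div, abs_sub_comm (γ₂ * prior P 1)]

end

end SDU

/-! ### The excess risk bound for both sampling schemes -/

theorem mainTheorem4
    {X : Type*} [MeasurableSpace X] (ν : Measure X) [SigmaFinite ν]
    (P : Measure (X × ℤˣ)) [IsProbabilityMeasure P] (hPν : unlabeledLaw P ≪ ν)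
    (hπ : prior P 1 ≠ prior P (-1))
    (l : ℝ → ℤˣ → ℝ) (hl_nonneg : ∀ z t, 0 ≤ l z t)
    (ρ : ℝ≥0) (hρ : 0 < ρ) (hl_lip : ∀ t, LipschitzWith ρ (fun z => l z t))
    (F : Set (X → ℝ)) (hF : PointwiseMeasurable F)
    (Cb : ℝ) (hCb : ∀ f ∈ F, ∀ x, |f x| ≤ Cb)
    (CF : ℝ)
    (hCF : ∀ n : ℕ, 0 < n → ∀ μ : Measure X, IsProbabilityMeasure μ → μ ≪ ν →
      rademacher F n μ ≤ CF / √(n : ℝ))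
    (fstar : X → ℝ) (hfstar : fstar ∈ F) (hfstar_min : IsMinOn (risk P l) F fstar)
    (γ₁ γ₂ γ₃ : ℝ) (hγ₁ : 0 ≤ γ₁) (hγ₂ : 0 ≤ γ₂) (hγ₃ : 0 ≤ γ₃) (hγ : γ₁ + γ₂ + γ₃ = 1)
    (nS nD nU : ℕ) (hnS : 0 < nS) (hnD : 0 < nD) (hnU : 0 < nU)
    {Ω : Type*} [MeasurableSpace Ω] (Pr : Measure Ω) [IsProbabilityMeasure Pr]
    (xS : Fin nS → Ω → X × X) (xD : Fin nD → Ω → X × X) (xU : Fin nU → Ω → X)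
    (hxU : IsIID Pr xU (unlabeledLaw P))
    (fhat : Ω → X → ℝ)
    (hfhat : ∀ᵐ ω ∂Pr, fhat ω ∈ F ∧
      IsMinOn (empSDU P l γ₁ γ₂ γ₃ (fun i => xS i ω) (fun i => xD i ω) (fun i => xU i ω))
        F (fhat ω))
    (δ : ℝ) (hδ : 0 < δ) :
    -- the `2 nS` similar points are i.i.d., and so are the `2 nD` dissimilar points
    (IsIID Pr xS ((simPointLaw P).prod (simPointLaw P)) →
      IsIID Pr xD ((disPointLaw P).prod (disPointLaw P)) →
      Pr {ω | ¬ (risk P l (fhat ω) - risk P l fstar ≤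
        boundConst P ρ CF (lossSup l Cb) δ *
          ((2 * γ₁ + γ₃) * (simProp P / √(2 * (nS : ℝ)))
            + (2 * γ₂ + γ₃) * (disProp P / √(2 * (nD : ℝ)))
            + (|γ₁ * prior P (-1) - γ₂ * prior P 1| + |γ₁ * prior P 1 - γ₂ * prior P (-1)|)
              * (1 / √(nU : ℝ))))} ≤ ENNReal.ofReal δ) ∧
    -- only the pairs are i.i.d., with laws `p_S` and `p_D`
    (IsIID Pr xS (simPairLaw P) →
      IsIID Pr xD (disPairLaw P) →
      Pr {ω | ¬ (risk P l (fhat ω) - risk P l fstar ≤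
        boundConst P ρ CF (lossSup l Cb) δ *
          ((2 * γ₁ + γ₃) * (simProp P / √(nS : ℝ))
            + (2 * γ₂ + γ₃) * (disProp P / √(nD : ℝ))
            + (|γ₁ * prior P (-1) - γ₂ * prior P 1| + |γ₁ * prior P 1 - γ₂ * prior P (-1)|)
              * (1 / √(nU : ℝ))))} ≤ ENNReal.ofReal δ) := by
  -- For `δ ≥ 1` the claim is trivial; otherwise `log (12 / δ)` is nonnegative, as the tail bounds
  -- require.
  rcases le_or_gt 1 δ with hδ1 | hδ1
  · have h1 : ∀ s : Set Ω, Pr s ≤ ENNReal.ofReal δ := fun s =>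
      prob_le_one.trans (by simpa using ENNReal.ofReal_le_ofReal hδ1)
    exact ⟨fun _ _ => h1 _, fun _ _ => h1 _⟩
  have hpU : IsProbabilityMeasure (unlabeledLaw P) := hxU.isProbabilityMeasure hnU
  -- A point of `X` is needed to see `Cb ≥ 0`, so that `0` lies in `[-Cb, Cb]` and `lossSup l Cb` is
  -- nonnegative.
  obtain ⟨x₀⟩ := nonempty_of_isProbabilityMeasure (unlabeledLaw P)
  have hCb0 : |(0 : ℝ)| ≤ Cb := by simpa using (abs_nonneg _).trans (hCb _ hfstar x₀)
  have hcl : ControlledClass ν F Cb CF := ⟨⟨fstar, hfstar⟩, hF, hCb, hCF⟩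
  have hCl : 0 ≤ lossSup l Cb := (hl_nonneg 0 1).trans (le_lossSup hl_lip hCb0 1)
  set L := Real.log (12 / δ) with hL_def
  have hL : 0 ≤ L := Real.log_nonneg (by rw [le_div_iff₀ hδ]; linarith)
  have hexp : Real.exp (-L) = δ / 12 := by
    rw [hL_def, Real.exp_neg, Real.exp_log (by positivity), inv_div]
  -- Three samples with two tails each, of probability `δ / 12`, make `δ / 2` in total.
  have hηδ : 2 * ENNReal.ofReal (Real.exp (-L)) + 2 * ENNReal.ofReal (Real.exp (-L))
      + 2 * ENNReal.ofReal (Real.exp (-L)) ≤ ENNReal.ofReal δ := by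
    rw [show (2 : ℝ≥0∞) = ENNReal.ofReal 2 by simp, ← ENNReal.ofReal_mul zero_le_two,
      ← ENNReal.ofReal_add (by positivity) (by positivity),
      ← ENNReal.ofReal_add (by positivity) (by positivity), hexp]
    exact ENNReal.ofReal_le_ofReal (by linarith)
  have hlip (a b : ℝ) := lipschitzWith_combLoss hl_lip a b
  have hosc (a b z z' : ℝ) (hz : |z| ≤ Cb) (hz' : |z'| ≤ Cb) :
      |combLoss l a b z - combLoss l a b z'|
        ≤ (((‖a‖₊ + ‖b‖₊) * (lossSup l Cb).toNNReal : ℝ≥0) : ℝ) := by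
    push_cast
    rw [Real.coe_toNNReal _ hCl]
    exact abs_combLoss_sub_le hl_nonneg hl_lip a b hz hz'
  have hrad (a b : ℝ) (n : ℕ) : deviationRadius CF (((‖a‖₊ + ‖b‖₊) * ρ : ℝ≥0) : ℝ)
      (((‖a‖₊ + ‖b‖₊) * (lossSup l Cb).toNNReal : ℝ≥0) : ℝ) L n
      = combRadius l ρ Cb CF L a b n := by
    push_cast
    rw [Real.coe_toNNReal _ hCl]
    rfl
  have hlm (t : ℤˣ) (f : X → ℝ) (hf : f ∈ F) : Measurable fun x => l (f x) t :=
    (hl_lip t).continuous.measurable.comp (hF.1 f hf)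
  have hlB (f : X → ℝ) (hf : f ∈ F) (x : X) (t : ℤˣ) : |l (f x) t| ≤ lossSup l Cb := by
    rw [abs_of_nonneg (hl_nonneg _ _)]
    exact le_lossSup hl_lip (hCb f hf x) t
  have hcm (a b : ℝ) (f : X → ℝ) (hf : f ∈ F) : Measurable fun x => combLoss l a b (f x) :=
    (hlip a b).continuous.measurable.comp (hF.1 f hf)
  have hcB (a b : ℝ) (f : X → ℝ) (hf : f ∈ F) (x : X) :=
    abs_comp_le_of_lipschitzWith (hlip a b) (hCb f hf x)
  have hU : Pr {ω | ∃ f ∈ F, combRadius l ρ Cb CF L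
      ((γ₂ * prior P 1 - γ₁ * prior P (-1)) / (prior P 1 - prior P (-1)))
      ((γ₁ * prior P 1 - γ₂ * prior P (-1)) / (prior P 1 - prior P (-1))) nU
      < |∫ x, unlabeledLoss l P γ₁ γ₂ (f x) ∂(unlabeledLaw P)
        - pointMean (fun i => xU i ω) f (unlabeledLoss l P γ₁ γ₂)|}
      ≤ 2 * ENNReal.ofReal (Real.exp (-L)) := by
    have h (a b : ℝ) := hcl.measure_pointMean_deviation_le (hlip a b) (hosc a b) (unlabeledLaw P) hPν hnU hL
    simp only [hrad] at h
    exact (hxU.measure_mem_le _).trans (h _ _)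
  -- Common to both claims: only the form of the expectations `ES`, `ED` and the effective sample
  -- sizes `mS`, `mD` depend on the sampling scheme.
  have key (ES ED : (X → ℝ) → ℝ) (mS mD : ℕ)
      (hES : ∀ f ∈ F, simProp P * ES f
        = prior P 1 * classIntegral P 1 (fun x => simLoss l P γ₁ γ₃ (f x))
          + prior P (-1) * classIntegral P (-1) fun x => simLoss l P γ₁ γ₃ (f x))
      (hED : ∀ f ∈ F, disProp P * ED f
        = prior P (-1) * classIntegral P 1 (fun x => disLoss l P γ₂ γ₃ (f x))
          + prior P 1 * classIntegral P (-1) fun x => disLoss l P γ₂ γ₃ (f x))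
      (hS : Pr {ω | ∃ f ∈ F, combRadius l ρ Cb CF L
        ((γ₁ + γ₃ * prior P 1) / (prior P 1 - prior P (-1)))
        (-(γ₁ + γ₃ * prior P (-1)) / (prior P 1 - prior P (-1))) mS
        < |ES f - pairMean (fun i => xS i ω) f (simLoss l P γ₁ γ₃)|}
        ≤ 2 * ENNReal.ofReal (Real.exp (-L)))
      (hD : Pr {ω | ∃ f ∈ F, combRadius l ρ Cb CF L
        (-(γ₂ + γ₃ * prior P (-1)) / (prior P 1 - prior P (-1)))
        ((γ₂ + γ₃ * prior P 1) / (prior P 1 - prior P (-1))) mD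
        < |ED f - pairMean (fun i => xD i ω) f (disLoss l P γ₂ γ₃)|}
        ≤ 2 * ENNReal.ofReal (Real.exp (-L))) :
      Pr {ω | ¬ (risk P l (fhat ω) - risk P l fstar ≤
        boundConst P ρ CF (lossSup l Cb) δ *
          ((2 * γ₁ + γ₃) * (simProp P / √(mS : ℝ))
            + (2 * γ₂ + γ₃) * (disProp P / √(mD : ℝ))
            + (|γ₁ * prior P (-1) - γ₂ * prior P 1| + |γ₁ * prior P 1 - γ₂ * prior P (-1)|)
              * (1 / √(nU : ℝ))))} ≤ ENNReal.ofReal δ := by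
    have h := (measure_excess_gt_le Pr (simProp_nonneg P) (disProp_nonneg P)
      (fun f hf => risk_eq l P hπ hγ (fun t => hlm t f hf) (hlB f hf) (hES f hf) (hED f hf)
        (integral_unlabeledLaw P (hcm _ _ f hf) (hcB _ _ f hf)))
      (fun ω f => empSDU_eq l P γ₁ γ₂ γ₃ (fun i => xS i ω) (fun i => xD i ω)
        (fun i => xU i ω) f) hfstar hfhat hS hD hU).trans hηδ
    refine le_of_eq_of_le ?_ h
    congr! 5
    rw [mul_add 2, mul_add 2, mul_left_comm 2, mul_left_comm 2]
    simp only [combRadius, two_mul_deviationRadius hCl]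
    rw [abs_simLoss_coeff P hγ₁ hγ₃, abs_unlabeledLoss_coeff,
      add_comm |-(γ₂ + _) / _|, abs_simLoss_coeff P hγ₂ hγ₃, boundConst, ← hL_def]
    ring
  refine ⟨fun hxS hxD => ?_, fun hxS hxD => ?_⟩
  -- A conditional law given a null event is the zero measure; the existence of a sample rules this
  -- out.
  · have hpS := isProbabilityMeasure_of_prod_self (hxS.isProbabilityMeasure hnS)
    have hpD := isProbabilityMeasure_of_prod_self (hxD.isProbabilityMeasure hnD)
    have hcS : simPointLaw P ≪ ν := (map_fst_cond_absolutelyContinuous P _).trans hPν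
    have hcD : disPointLaw P ≪ ν := (map_fst_cond_absolutelyContinuous P _).trans hPν
    have h := key (fun f => ∫ x, simLoss l P γ₁ γ₃ (f x) ∂(simPointLaw P))
      (fun f => ∫ x, disLoss l P γ₂ γ₃ (f x) ∂(disPointLaw P)) (nS + nS) (nD + nD)
      (fun f hf => simProp_mul_integral_point P (hcm _ _ f hf) (hcB _ _ f hf))
      (fun f hf => disProp_mul_integral_point P (hcm _ _ f hf) (hcB _ _ f hf)) ?_ ?_
    · push_cast at h
      rwa [← two_mul (nS : ℝ), ← two_mul (nD : ℝ)] at h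
    · have h (a b : ℝ) := hcl.measure_pairMean_prod_deviation_le (hlip a b) (hosc a b)
        (simPointLaw P) hcS hnS hL
      simp only [hrad] at h
      exact (hxS.measure_mem_le _).trans (h _ _)
    · have h (a b : ℝ) := hcl.measure_pairMean_prod_deviation_le (hlip a b) (hosc a b)
        (disPointLaw P) hcD hnD hL
      simp only [hrad] at h
      exact (hxD.measure_mem_le _).trans (h _ _)
  · have hpS := hxS.isProbabilityMeasure hnS
    have hpD := hxD.isProbabilityMeasure hnD
    refine key (fun f => ∫ q, (simLoss l P γ₁ γ₃ (f q.1) + simLoss l P γ₁ γ₃ (f q.2)) / 2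
        ∂(simPairLaw P))
      (fun f => ∫ q, (disLoss l P γ₂ γ₃ (f q.1) + disLoss l P γ₂ γ₃ (f q.2)) / 2
        ∂(disPairLaw P)) nS nD
      (fun f hf => simProp_mul_integral_pair P (hcm _ _ f hf) (hcB _ _ f hf))
      (fun f hf => disProp_mul_integral_pair P (hcm _ _ f hf) (hcB _ _ f hf)) ?_ ?_
    · have h (a b : ℝ) := hcl.measure_pairMean_deviation_le (hlip a b) (hosc a b) (simPairLaw P)
        ((map_fst_cond_absolutelyContinuous P _).trans hPν)
        ((map_snd_cond_absolutelyContinuous P _).trans hPν) hnS hL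
      simp only [hrad] at h
      exact (hxS.measure_mem_le _).trans (h _ _)
    · have h (a b : ℝ) := hcl.measure_pairMean_deviation_le (hlip a b) (hosc a b) (disPairLaw P)
        ((map_fst_cond_absolutelyContinuous P _).trans hPν)
        ((map_snd_cond_absolutelyContinuous P _).trans hPν) hnD hL
      simp only [hrad] at h
      exact (hxD.measure_mem_le _).trans (h _ _)
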